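/- Let $k\ge r\ge 2$ be integers. An $r$-graph $\mathcal H$ is a collection of $r$-element subsets (edges) of a finite vertex set $V(\mathcal H)$. Its shadow $\partial\mathcal H$ is the family of all $(r-1)$-sets contained in an edge, the degree $d_{\mathcal H}(S)$ of an $(r-1)$-set $S\subseteq V(\mathcal H)$ is the number of vertices $v$ with $S\cup\{v\}\in\mathcal H$, and the minimum positive codegree is $\delta^+_{r-1}(\mathcal H)=\min\{d_{\mathcal H}(S): S\in\partial\mathcal H\}$. A vertex is isolated if it lies in no edge. A homomorphism of $r$-graphs is a map of vertex sets that sends every edge onto an edge, and an automorphism of an $r$-graph is a surjective homomorphism to itself. Let $K_k^r$ be the complete $r$-graph on $[k]=\{1,\dots,k\}$. We call $\mathcal H$ $k$-partite (or $k$-colorable) if it has a homomorphism to $K_k^r$, and uniquely $k$-colorable if it is $k$-colorable and for any two homomorphisms $\psi_1,\psi_2:\mathcal H\to K_k^r$ there is an automorphism $\eta$ of $K_k^r$ with $\eta\circ\psi_1=\psi_2$. For a real $\alpha>0$ and an integer $m\ge1$ let $\mathcal H_{k,r}(\alpha,m)$ be the following $r$-graph. Its vertex set is the disjoint union of parts $V_1,\dots,V_{k-2}$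 of size $\lfloor\alpha m\rfloor$ and $V_{k-1,1},V_{k-1,2},V_{k,1},V_{k,2}$ of size $m$. Its edges are the $r$-sets $e$ such that, for some $j\in\{1,2\}$, $e\subseteq V_1\cup\dots\cup V_{k-2}\cup V_{k-1,j}\cup V_{k,j}$ and $e$ meets each of the parts in at most one vertex. **Theorem.** Let $k\ge r\ge2$ be integers, and put $$\phi_{k,r}=\begin{cases}\dfrac{k-r+1}{k+2}, & k<\dfrac{4r-2}{3},\\[2mm] \dfrac{3k-3r+1}{3k-2}, & k\ge\dfrac{4r-2}{3}.\end{cases}$$ 1. For every $n\ge k$, every $k$-partite $r$-graph $\mathcal H$ on $n$ vertices without isolated vertices and with $\delta^+_{r-1}(\mathcal H)>\phi_{k,r}\,n$ is uniquely $k$-colorable. 2. The constant is optimal: $\phi_{k,r}$ is the minimum real number $c$ such that, for every $n\ge k$, every $k$-partite $r$-graph $\mathcal H$ on $n$ vertices without isolated vertices and with $\delta^+_{r-1}(\mathcal H)>c\,n$ is uniquely $k$-colorable. That is, this minimum $\Phi_{k,r}$ exists and $$\Phi_{k,r}=\max\Big\{\frac{k-r+1}{k+2},\ \frac{3k-3r+1}{3k-2}\Big\}.$$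 3. For every $m\ge1$, each of $\mathcal H_{k,r}(1,m)$ and $\mathcal H_{k,r}(3,m)$ has at least $k$ vertices, is $k$-partite, has no isolated vertices and is not uniquely $k$-colorable. Moreover, with $v(\mathcal H)=|V(\mathcal H)|$, $$\delta^+_{r-1}(\mathcal H_{k,r}(1,m))=\frac{k-r+1}{k+2}\,v(\mathcal H_{k,r}(1,m)),\qquad \delta^+_{r-1}(\mathcal H_{k,r}(3,m))=\frac{3k-3r+1}{3k-2}\,v(\mathcal H_{k,r}(3,m)).$$ -/

import Mathlib

/-- An `r`-graph on the finite vertex set `V`: a collection of `r`-element subsets of `V`. -/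
@[ext]
structure RGraph (V : Type*) (r : ℕ) where
  /-- The set of edges. -/
  edges : Finset (Finset V)
  /-- Every edge has exactly `r` vertices. -/
  sized : (edges : Set (Finset V)).Sized r

namespace RGraph

section Basic

variable {V W : Type*} {r : ℕ}

/-- No vertex is isolated: every vertex lies in some edge. -/
def NoIsolated (H : RGraph V r) : Prop :=
  ∀ v : V, ∃ e ∈ H.edges, v ∈ e

/-- The degree of a vertex set `S`: the number of vertices `v` such that `S ∪ {v}` is an edge.
(For `S` with `r - 1` elements such a `v` is never in `S`.) -/
def setDegree [Fintype V] [DecidableEq V] (H : RGraph V r) (S : Finset V) : ℕ :=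
  (Finset.univ.filter fun v => insert v S ∈ H.edges).card

/-- The minimum positive codegree: the least degree of a set in the shadow of `H`, the shadow being
the family of all `(r - 1)`-sets that are contained in an edge.
(It takes the value `0` if there is no edge at all.) -/
noncomputable def minPosCodegree [Fintype V] [DecidableEq V] (H : RGraph V r) : ℕ :=
  sInf {d | ∃ S ∈ H.edges.shadow, H.setDegree S = d}

/-- `ψ` is a homomorphism from `H` to `G`: the image of every edge is an edge. -/
def IsHom [DecidableEq W] (H : RGraph V r) (G : RGraph W r) (ψ : V → W) : Prop :=
  ∀ e ∈ H.edges, e.image ψ ∈ G.edges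

/-- `η` is an automorphism of `G`: a surjective homomorphism from `G` to itself. -/
def IsAut [DecidableEq W] (G : RGraph W r) (η : W → W) : Prop :=
  G.IsHom G η ∧ Function.Surjective η

/-- Two maps to the vertex set of `G` are equivalent if they differ by an automorphism of `G`. -/
def HomEquiv [DecidableEq W] (G : RGraph W r) (ψ₁ ψ₂ : V → W) : Prop :=
  ∃ η : W → W, G.IsAut η ∧ η ∘ ψ₁ = ψ₂

/-- The complete `r`-graph on `k` vertices. -/
def complete (k r : ℕ) : RGraph (Fin k) r where
  edges := Finset.powersetCard r Finset.univ
  sized := fun _ he => (Finset.mem_powersetCard.mp he).2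

/-- `H` is `k`-colorable, that is `k`-partite: it has a homomorphism to the complete `r`-graph on
`k` vertices. -/
def Colorable (H : RGraph V r) (k : ℕ) : Prop :=
  ∃ ψ : V → Fin k, H.IsHom (complete k r) ψ

/-- `H` is uniquely `k`-colorable: it is `k`-colorable, and any two of its homomorphisms to the
complete `r`-graph on `k` vertices are equivalent. -/
def UniquelyColorable (H : RGraph V r) (k : ℕ) : Prop :=
  H.Colorable k ∧
    ∀ ψ₁ ψ₂ : V → Fin k, H.IsHom (complete k r) ψ₁ → H.IsHom (complete k r) ψ₂ →
      (complete k r).HomEquiv ψ₁ ψ₂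

end Basic

section Construction

/-- Vertices of the construction: `k - 2` parts of size `a` (`Sum.inl (i, x)` lies in the `i`-th of
them), and four parts of size `m` (`Sum.inr (s, j, x)` lies in the part called `V_{k-1,j+1}` in the
usual notation if `s = 0`, and in `V_{k,j+1}` if `s = 1`). -/
abbrev BlowupVertex (k a m : ℕ) : Type :=
  (Fin (k - 2) × Fin a) ⊕ (Fin 2 × Fin 2 × Fin m)

/-- The name of the part that contains a given vertex. -/
def partOf {k a m : ℕ} : BlowupVertex k a m → Fin (k - 2) ⊕ (Fin 2 × Fin 2)
  | Sum.inl p => Sum.inl p.1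
  | Sum.inr q => Sum.inr (q.1, q.2.1)

/-- For `j = 0` (resp. `j = 1`) this is the set `U_1` (resp. `U_2`): all vertices, except those of
the two parts `Sum.inr (s, j')` with `j' ≠ j`. -/
def halfSet (k a m : ℕ) (j : Fin 2) : Finset (BlowupVertex k a m) :=
  Finset.univ.filter fun v => ∀ s j' : Fin 2, partOf v = Sum.inr (s, j') → j' = j

/-- The `r`-graph whose edges are the `r`-sets that are contained in one of the two sets
`halfSet k a m j` and meet every part in at most one vertex. -/
def twoHalves (k r a m : ℕ) : RGraph (BlowupVertex k a m) r where
  edges := (Finset.powersetCard r Finset.univ).filter fun e =>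
    ∃ j : Fin 2, e ⊆ halfSet k a m j ∧ ∀ p, (e.filter fun v => partOf v = p).card ≤ 1
  sized := fun _ he => (Finset.mem_powersetCard.mp (Finset.mem_filter.mp he).1).2

/-- The `r`-graph `H_{k,r}(α, m)`: the `k - 2` ordinary parts have size `⌊α m⌋`, the four
remaining ones have size `m`. -/
noncomputable def construction (k r : ℕ) (α : ℝ) (m : ℕ) :
    RGraph (BlowupVertex k ⌊α * m⌋₊ m) r :=
  twoHalves k r ⌊α * m⌋₊ m

end Construction

/-- The constant of the main result. -/
noncomputable def threshold (k r : ℕ) : ℝ :=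
  if (k : ℝ) < (4 * (r : ℝ) - 2) / 3 then ((k : ℝ) - r + 1) / (k + 2)
  else (3 * (k : ℝ) - 3 * r + 1) / (3 * k - 2)

/-- The set of all real `c` such that, for all `n ≥ k`, every `k`-partite `r`-graph on `n` vertices
without isolated vertices and with minimum positive codegree greater than `c * n` is uniquely
`k`-colorable. The number `Φ_{k,r}` is the minimum of this set. -/
def forcingConstants (k r : ℕ) : Set ℝ :=
  {c | ∀ (V : Type) [Fintype V] [DecidableEq V] (H : RGraph V r),
    k ≤ Fintype.card V → H.Colorable k → H.NoIsolated →
    c * (Fintype.card V : ℝ) < (H.minPosCodegree : ℝ) → H.UniquelyColorable k}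

end RGraph

/-! Two colourings send each vertex to its pair of colours in `Fin k × Fin k`. The images of the
edges form an `r`-uniform family, in which a pair is weighted by the number of vertices mapped to
it, and weighted codegrees are at least the original ones. Pairs in a common edge differ in both
coordinates, so a clique of `k - 1` pairs has at most one common neighbour. If the occurring pairs
form a clique of size `k`, they are the graph of a permutation of the colours, and the colourings
are equivalent. `isClique_of_lt_codegree` proves that they do, by induction on `r`.

Let `N` be the total weight, and put `g = 3N/(3k-2)` or `g = N/(k+2)` according to the regime. A
vertex missing weight at least `g` has a link so light that the induction hypothesis applies with `k
- 1` and `r - 1`; its neighbourhood is then a clique of size `k - 1`, and an exchange argument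
(`lt_sum_mul_of_card_commonNbrs`) makes the vertex `Rigid`. So every vertex is good (misses less
than `g`) or rigid.

`isClique_of_good_or_rigid` takes a largest clique `T` whose common neighbourhood `Y` is not a
clique. Then `Y` splits into cliques, each completing `T` to `k` vertices. Either `|T| = k - 2` in
the first regime and two disjoint pairs in `Y` are too heavy (`pair_contradiction`), or some
component with at most half the weight of `Y` consists of rigid vertices, and averaging contradicts
rigidity (`average_contradiction`).

For optimality, two complete `k`-partite halves share `k - 2` parts; swapping the last two colours
on one half only gives an inequivalent colouring. Sizes `a = m` and `a = 3m` of the shared parts are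
the extremes for which the least positive codegree is `(k - r)a + m`. -/

namespace CodegreeRigidity

/-! ### Numerical contradictions -/

section Numerics

/-- Two disjoint pairs in the common neighbourhood of `K - 2` vertices are impossible. -/
theorem pair_contradiction {K R s τ N δ p q : ℝ} (hreg : 4 * R ≤ 3 * K + 2)
    (hN : N = (3 * K - 2) * s) (hδ : δ = (3 * K - 3 * R + 1) * s) (hτ : τ ≤ 3 * s)
    (hY : p + q + (K - 2) * τ ≤ N) (hp : 2 * δ < p + 2 * (K - R) * τ)
    (hq : 2 * δ < q + 2 * (K - R) * τ) : False := by
  -- Adding `hp` and `hq` and using `hY` gives `4δ < N + (3K - 4R + 2)τ`; at `τ = 3s` the right side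
  -- is exactly `4δ`.
  have h : 0 ≤ (3 * K - 4 * R + 2) * (3 * s - τ) :=
    mul_nonneg (by linarith) (by linarith)
  subst hN hδ
  nlinarith

/-- Here `J` and `η` are the size and average weight of a component of at most half the weight of
`Y`, and `τ` is the average loss per vertex of `T`. The bounds `h1`, `h2`, `h3` come from three
choices of coefficients at a rigid vertex. -/
theorem average_contradiction {K R J s τ η N δ : ℝ} (hRK : R ≤ K)
    (hJ : 2 ≤ J) (hs : 0 < s)
    (hY : 2 * J * η + (K - J) * τ ≤ N)
    (h1 : (K - 1) * δ < (K - R + 1) * ((K - J) * τ + (J - 1) * η))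
    (h2 : J - 1 ≤ K - R + 1 → δ < (K - R + 1 - (J - 1)) * τ + (J - 1) * η)
    (h3 : K - R + 1 < J - 1 → δ < (K - R + 1) * η)
    (hreg : (4 * R ≤ 3 * K + 2 ∧ N = (3 * K - 2) * s ∧ δ = (3 * K - 3 * R + 1) * s ∧ τ ≤ 3 * s) ∨
      (3 * K + 2 ≤ 4 * R ∧ N = (K + 2) * s ∧ δ = (K - R + 1) * s ∧ τ ≤ s)) : False := by
  obtain ⟨q, hq⟩ : ∃ q, q = K - R + 1 := ⟨_, rfl⟩
  rw [← hq] at h1 h2 h3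
  have hq1 : 1 ≤ q := by linarith
  have hδ0 : 0 ≤ δ := by
    rcases hreg with ⟨-, -, h, -⟩ | ⟨-, -, h, -⟩ <;> rw [h] <;> apply mul_nonneg <;> linarith
  have hqN : q * N ≤ (K + 2) * δ := by
    rcases hreg with ⟨h, hN, hd, -⟩ | ⟨h, hN, hd, -⟩
    · rw [hN, hd, hq]
      have : 0 ≤ (6 * K - 8 * R + 4) * s := mul_nonneg (by linarith) hs.le
      nlinarith
    · rw [hN, hd, hq]
      apply le_of_eq
      ring
  have hJδ : (K + 2) * δ ≤ (K + J) * δ := mul_le_mul_of_nonneg_right (by linarith) hδ0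
  have hqY : q * (2 * J * η + (K - J) * τ) ≤ q * N := mul_le_mul_of_nonneg_left hY (by linarith)
  -- If `δ ≤ qη`, adding `J + 1` copies of this to `h1` gives more than `(K + J)δ`, against `hqY`.
  -- Otherwise `h3` is out of reach, so `h2` applies.
  rcases le_or_gt δ (q * η) with hη | hη
  · have : (J + 1) * δ ≤ (J + 1) * (q * η) := mul_le_mul_of_nonneg_left hη (by linarith)
    nlinarith
  have hJq : J - 1 ≤ q := by
    by_contra hcon
    linarith [h3 (not_le.mp hcon)]
  have h2 := h2 hJq
  rcases hreg with ⟨h, hN, hd, hτs⟩ | ⟨h, hN, hd, hτs⟩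
  · have hη' : (J - 1) * (q * η) ≤ (J - 1) * δ := mul_le_mul_of_nonneg_left hη.le (by linarith)
    have hqτ : δ < q * τ := by
      by_contra hcon
      have e1 : (q - (J - 1)) * (q * τ) ≤ (q - (J - 1)) * δ :=
        mul_le_mul_of_nonneg_left (not_lt.mp hcon) (by linarith)
      have e2 : q * δ < q * ((q - (J - 1)) * τ + (J - 1) * η) :=
        mul_lt_mul_of_pos_left h2 (by linarith)
      nlinarith
    have f1 : (J - 1) * (2 * J * η + (K - J) * τ) ≤ (J - 1) * N :=
      mul_le_mul_of_nonneg_left hY (by linarith)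
    have f2 : 2 * J * δ < 2 * J * ((q - (J - 1)) * τ + (J - 1) * η) :=
      mul_lt_mul_of_pos_left h2 (by linarith)
    have f3 : 2 * J * δ + ((J - 1) * (K - J) - 2 * J * (q - (J - 1))) * τ < (J - 1) * N := by
      nlinarith
    -- With `η` eliminated only `τ` remains: the sign of its coefficient decides whether the lower
    -- bound `δ < qτ` or the upper bound `τ ≤ 3s` is the useful one.
    rcases le_or_gt 0 ((J - 1) * (K - J) - 2 * J * (q - (J - 1))) with hC | hC
    · have g1 := mul_le_mul_of_nonneg_left hqτ.le hC
      have g2 := mul_lt_mul_of_pos_left f3 (show 0 < q by linarith)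
      have g3 : (J - 1) * (q * N) ≤ (J - 1) * ((K + J) * δ) :=
        mul_le_mul_of_nonneg_left (hqN.trans hJδ) (by linarith)
      nlinarith
    · have g1 := mul_le_mul_of_nonpos_left hτs hC.le
      have g2 : 0 ≤ (3 * J + 1) * (J - 2) * s :=
        mul_nonneg (mul_nonneg (by linarith) (by linarith)) hs.le
      have hd' : δ = (3 * q - 2) * s := by rw [hd, hq]; ring
      rw [hd', hN] at f3
      nlinarith
  · rw [← hq] at hd
    have hηs : η < s := by
      rw [hd] at hη
      exact lt_of_mul_lt_mul_left hη (by linarith)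
    have e1 : (q - (J - 1)) * τ ≤ (q - (J - 1)) * s :=
      mul_le_mul_of_nonneg_left hτs (by linarith)
    have e2 : (J - 1) * η ≤ (J - 1) * s := mul_le_mul_of_nonneg_left hηs.le (by linarith)
    nlinarith

end Numerics

/-! ### Common neighbourhoods in a weighted graph -/

section CommonNeighbors

open Finset

variable {V : Type*}

open Classical in
/-- The vertices of `U` that are adjacent to all vertices of `T`. -/
noncomputable def commonNbrs (G : SimpleGraph V) (U T : Finset V) : Finset V :=
  U.filter fun v => ∀ t ∈ T, G.Adj t v

variable {G : SimpleGraph V} {U T T' : Finset V} {u v : V}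

theorem mem_commonNbrs : v ∈ commonNbrs G U T ↔ v ∈ U ∧ ∀ t ∈ T, G.Adj t v := by
  classical
  simp [commonNbrs]

theorem commonNbrs_subset : commonNbrs G U T ⊆ U := fun _ hv => (mem_commonNbrs.mp hv).1

theorem commonNbrs_anti (h : T ⊆ T') : commonNbrs G U T' ⊆ commonNbrs G U T := fun _ hv =>
  mem_commonNbrs.mpr ⟨(mem_commonNbrs.mp hv).1, fun t ht => (mem_commonNbrs.mp hv).2 t (h ht)⟩

theorem commonNbrs_empty : commonNbrs G U ∅ = U := by
  ext; simp [mem_commonNbrs]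

theorem mem_commonNbrs_singleton : v ∈ commonNbrs G U {u} ↔ v ∈ U ∧ G.Adj u v := by
  simp [mem_commonNbrs]

theorem notMem_of_mem_commonNbrs (hv : v ∈ commonNbrs G U T) : v ∉ T := fun h =>
  G.irrefl ((mem_commonNbrs.mp hv).2 v h)

theorem mem_commonNbrs_insert [DecidableEq V] :
    v ∈ commonNbrs G U (insert u T) ↔ v ∈ commonNbrs G U T ∧ G.Adj u v := by
  simp only [mem_commonNbrs, Finset.mem_insert, forall_eq_or_imp]
  tauto

theorem isClique_insert_of_mem [DecidableEq V] (hT : G.IsClique (T : Set V))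
    (hv : v ∈ commonNbrs G U T) : G.IsClique ((insert v T : Finset V) : Set V) := by
  rw [Finset.coe_insert, SimpleGraph.isClique_insert]
  exact ⟨hT, fun t ht _ => ((mem_commonNbrs.mp hv).2 t ht).symm⟩

/-- The vertices of `U` outside the common neighbourhood of `T` weigh at most as much as the
non-neighbours of the vertices of `T` in total. -/
theorem sum_sub_sum_commonNbrs_le {w : V → ℝ} (hw : ∀ v, 0 ≤ w v) (T : Finset V) :
    ∑ v ∈ U, w v - ∑ v ∈ commonNbrs G U T, w v ≤
      ∑ t ∈ T, (∑ v ∈ U, w v - ∑ v ∈ commonNbrs G U {t}, w v) := by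
  classical
  induction T using Finset.induction_on with
  | empty => simp [commonNbrs_empty]
  | insert t T ht ih =>
    rw [Finset.sum_insert ht]
    have h : commonNbrs G U (insert t T) = commonNbrs G U {t} ∩ commonNbrs G U T := by
      ext v
      simp only [mem_commonNbrs_insert, Finset.mem_inter, mem_commonNbrs_singleton]
      exact ⟨fun h => ⟨⟨commonNbrs_subset h.1, h.2⟩, h.1⟩, fun h => ⟨h.2, h.1.2⟩⟩
    have h1 := Finset.sum_union_inter (s₁ := commonNbrs G U {t}) (s₂ := commonNbrs G U T) (f := w)
    have h2 : ∑ v ∈ commonNbrs G U {t} ∪ commonNbrs G U T, w v ≤ ∑ v ∈ U, w v :=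
      Finset.sum_le_sum_of_subset_of_nonneg
        (Finset.union_subset commonNbrs_subset commonNbrs_subset) fun v _ _ => hw v
    rw [h]
    linarith

/-- In a larger clique, any `k - 1` vertices would leave two others as distinct common neighbours.
-/
theorem card_le_of_star {k : ℕ} (hk : 1 ≤ k)
    (star : ∀ T ⊆ U, G.IsClique (T : Set V) → T.card = k - 1 →
      ∀ x ∈ commonNbrs G U T, ∀ y ∈ commonNbrs G U T, x = y)
    (hTU : T ⊆ U) (hT : G.IsClique (T : Set V)) : T.card ≤ k := by
  classical
  by_contra hcon
  obtain ⟨T₀, hT₀, hcard⟩ := Finset.exists_subset_card_eq (show k - 1 ≤ T.card by omega)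
  have hsd : 1 < (T \ T₀).card := by
    rw [Finset.card_sdiff_of_subset hT₀]
    omega
  obtain ⟨x, hx, y, hy, hxy⟩ := Finset.one_lt_card.mp hsd
  have key : ∀ z ∈ T \ T₀, z ∈ commonNbrs G U T₀ := fun z hz => by
    rw [Finset.mem_sdiff] at hz
    refine mem_commonNbrs.mpr ⟨hTU hz.1, fun t ht => hT (hT₀ ht) hz.1 ?_⟩
    rintro rfl
    exact hz.2 ht
  exact hxy (star T₀ (hT₀.trans hTU) (hT.subset (by exact_mod_cast hT₀)) hcard x (key x hx) y
    (key y hy))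

end CommonNeighbors

open Finset

/-- A vertex `a` of a weighted graph is rigid if its neighbourhood is a clique of `k - 1` vertices
in which any `k - r + 1` vertices, also fractionally, weigh more than `δ`. -/
def Rigid {V : Type*} (G : SimpleGraph V) (U : Finset V) (w : V → ℝ) (k r : ℕ) (δ : ℝ) (a : V) :
    Prop :=
  G.IsClique (commonNbrs G U {a} : Set V) ∧ (commonNbrs G U {a}).card = k - 1 ∧
    ∀ c : V → ℝ, (∀ u, 0 ≤ c u) → (∀ u, c u ≤ 1) →
      ∑ u ∈ commonNbrs G U {a}, c u = (k : ℝ) - r + 1 →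
      δ < ∑ u ∈ commonNbrs G U {a}, c u * w u

/-! ### Rigid and good vertices around a maximal loose clique -/

section RigidVertices

variable {V : Type*} [DecidableEq V] {G : SimpleGraph V} {U T K : Finset V} {w : V → ℝ}
  {k r : ℕ} {δ g : ℝ} {a : V}

theorem Rigid.lt_two_values (ha : Rigid G U w k r δ a) (hTK : Disjoint T K)
    (hN : commonNbrs G U {a} = T ∪ K.erase a) (haK : a ∈ K) {α β : ℝ}
    (hα : 0 ≤ α) (hα' : α ≤ 1) (hβ : 0 ≤ β) (hβ' : β ≤ 1)
    (hsum : α * T.card + β * ((K.card : ℝ) - 1) = (k : ℝ) - r + 1) :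
    δ < α * ∑ v ∈ T, w v + β * (∑ v ∈ K, w v - w a) := by
  have hdisj : Disjoint T (K.erase a) := hTK.mono_right (Finset.erase_subset a K)
  have hcard : ((K.erase a).card : ℝ) = (K.card : ℝ) - 1 := by
    rw [Finset.card_erase_of_mem haK, Nat.cast_sub (Finset.card_pos.mpr ⟨a, haK⟩)]
    simp
  have hwK : ∑ v ∈ K.erase a, w v = ∑ v ∈ K, w v - w a := by
    rw [← Finset.add_sum_erase K w haK]
    ring
  have key : ∀ f : V → ℝ, ∑ u ∈ commonNbrs G U {a}, (if u ∈ T then α else β) * f u =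
      α * ∑ v ∈ T, f v + β * ∑ v ∈ K.erase a, f v := fun f => by
    rw [hN, Finset.sum_union hdisj, Finset.mul_sum, Finset.mul_sum]
    congr 1
    · exact Finset.sum_congr rfl fun u hu => by rw [if_pos hu]
    · exact Finset.sum_congr rfl fun u hu => by
        rw [if_neg fun h => Finset.disjoint_left.mp hdisj h hu]
  have h := ha.2.2 (fun u => if u ∈ T then α else β)
    (fun u => by split_ifs <;> assumption) (fun u => by split_ifs <;> assumption) (by
      have := key fun _ => 1
      simp only [mul_one, Finset.sum_const, nsmul_eq_mul, hcard] at this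
      rw [this, hsum])
  rwa [key, hwK] at h

/-- The closed neighbourhoods inside the common neighbourhood of a clique `T`, when every
larger clique has a common neighbourhood that is a clique. -/
theorem mem_insert_commonNbrs_of_adj
    (hmax : ∀ c ∈ commonNbrs G U T, G.IsClique (commonNbrs G U (insert c T) : Set V))
    {c d z : V} (hd : d ∈ insert c (commonNbrs G U (insert c T)))
    (hz : z ∈ commonNbrs G U T) (hc : c ∈ commonNbrs G U T) (hdz : G.Adj d z) :
    z ∈ insert c (commonNbrs G U (insert c T)) := by
  rw [Finset.mem_insert] at hd ⊢
  rcases hd with rfl | hd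
  · exact Or.inr (mem_commonNbrs_insert.mpr ⟨hz, hdz⟩)
  · rw [mem_commonNbrs_insert] at hd
    by_cases hzc : z = c
    · exact Or.inl hzc
    · refine Or.inr (mem_commonNbrs_insert.mpr ⟨hz, ?_⟩)
      exact hmax d hd.1 (mem_coe.mpr (mem_commonNbrs_insert.mpr ⟨hc, hd.2.symm⟩))
        (mem_coe.mpr (mem_commonNbrs_insert.mpr ⟨hz, hdz⟩)) (Ne.symm hzc)

/-- A neighbour of `a` outside `T` shares the clique of neighbours of `a` with all of `T`, so it
lies in the common neighbourhood of `T`, hence in the component of `a`. -/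
theorem commonNbrs_singleton_eq
    (hmax : ∀ c ∈ commonNbrs G U T, G.IsClique (commonNbrs G U (insert c T) : Set V))
    (hTU : T ⊆ U) {c : V} (hc : c ∈ commonNbrs G U T)
    (hKcl : G.IsClique ((insert c (commonNbrs G U (insert c T)) : Finset V) : Set V))
    (hKY : insert c (commonNbrs G U (insert c T)) ⊆ commonNbrs G U T)
    (ha : a ∈ insert c (commonNbrs G U (insert c T)))
    (hcl : G.IsClique (commonNbrs G U {a} : Set V)) :
    commonNbrs G U {a} = T ∪ (insert c (commonNbrs G U (insert c T))).erase a := by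
  have haY := hKY ha
  ext v
  rw [mem_commonNbrs_singleton, Finset.mem_union, Finset.mem_erase]
  constructor
  · rintro ⟨hvU, hav⟩
    by_cases hvT : v ∈ T
    · exact Or.inl hvT
    · refine Or.inr ⟨hav.ne', mem_insert_commonNbrs_of_adj hmax ha ?_ hc hav⟩
      refine mem_commonNbrs.mpr ⟨hvU, fun t ht => hcl ?_ ?_ ?_⟩
      · exact mem_coe.mpr
          (mem_commonNbrs_singleton.mpr ⟨hTU ht, ((mem_commonNbrs.mp haY).2 t ht).symm⟩)
      · exact mem_coe.mpr (mem_commonNbrs_singleton.mpr ⟨hvU, hav⟩)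
      · rintro rfl
        exact hvT ht
  · rintro (hvT | ⟨hva, hv⟩)
    · exact ⟨hTU hvT, ((mem_commonNbrs.mp haY).2 v hvT).symm⟩
    · exact ⟨commonNbrs_subset (hKY hv), hKcl (mem_coe.mpr ha) (mem_coe.mpr hv) (Ne.symm hva)⟩

/-- The vertex `a` misses itself and everything in `Y` outside its component `K`. -/
theorem sum_sub_lt_of_good (hw : ∀ v, 0 ≤ w v) {Y : Finset V} (hYU : Y ⊆ U) (haU : a ∈ U)
    (haK : a ∈ K)
    (hK : ∀ z ∈ Y, G.Adj a z → z ∈ K)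
    (hKY : K ⊆ Y)
    (hgood : ∑ v ∈ U, w v - ∑ v ∈ commonNbrs G U {a}, w v < g) :
    ∑ v ∈ Y, w v - ∑ v ∈ K, w v + w a < g := by
  have h1 : ∑ v ∈ insert a (Y \ K), w v = w a + (∑ v ∈ Y, w v - ∑ v ∈ K, w v) := by
    rw [Finset.sum_insert (by simp [haK]), ← Finset.sum_sdiff hKY]
    ring
  have hdisj : Disjoint (commonNbrs G U {a}) (insert a (Y \ K)) := by
    rw [Finset.disjoint_left]
    intro v hv hv'
    rw [mem_commonNbrs_singleton] at hv
    rw [Finset.mem_insert, Finset.mem_sdiff] at hv'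
    rcases hv' with rfl | hv'
    · exact G.irrefl hv.2
    · exact hv'.2 (hK v hv'.1 hv.2)
  have h2 := Finset.sum_union (f := w) hdisj
  have h3 : ∑ v ∈ commonNbrs G U {a} ∪ insert a (Y \ K), w v ≤ ∑ v ∈ U, w v :=
    Finset.sum_le_sum_of_subset_of_nonneg
      (Finset.union_subset commonNbrs_subset (Finset.insert_subset haU
        (Finset.sdiff_subset.trans hYU))) fun v _ _ => hw v
  linarith

end RigidVertices

/-! ### Graphs of good and rigid vertices are cliques -/

section RigidGraphs

variable {V : Type*} {G : SimpleGraph V} {U : Finset V} {w : V → ℝ}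
  {k r : ℕ} {δ g s : ℝ}

/-- At most `k - 1` good vertices together miss at most `(k - 1)g`, which is less than the total
weight in both regimes. -/
theorem commonNbrs_nonempty_of_good (hw : ∀ v, 0 ≤ w v) (hs : 0 < s)
    (hreg : (4 * (r : ℝ) ≤ 3 * k + 2 ∧ ∑ v ∈ U, w v = (3 * k - 2) * s ∧
        δ = (3 * k - 3 * r + 1) * s ∧ g = 3 * s) ∨
      (3 * (k : ℝ) + 2 ≤ 4 * r ∧ ∑ v ∈ U, w v = (k + 2) * s ∧
        δ = ((k : ℝ) - r + 1) * s ∧ g = s))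
    {T : Finset V} (hgood : ∀ t ∈ T, ∑ v ∈ U, w v - ∑ v ∈ commonNbrs G U {t}, w v < g)
    (hcard : T.card < k) : (commonNbrs G U T).Nonempty := by
  by_contra hcon
  rw [Finset.not_nonempty_iff_eq_empty] at hcon
  have h1 := sum_sub_sum_commonNbrs_le (G := G) (U := U) hw T
  have h2 : ∑ t ∈ T, (∑ v ∈ U, w v - ∑ v ∈ commonNbrs G U {t}, w v) ≤ T.card * g := by
    rw [← nsmul_eq_mul]
    exact Finset.sum_le_card_nsmul _ _ _ fun t ht => (hgood t ht).le
  rw [hcon, Finset.sum_empty, sub_zero] at h1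
  have h3 : (T.card : ℝ) ≤ k - 1 := by
    have : (T.card : ℝ) + 1 ≤ k := by exact_mod_cast hcard
    linarith
  have h4 : (T.card : ℝ) * s ≤ (k - 1) * s := mul_le_mul_of_nonneg_right h3 hs.le
  rcases hreg with ⟨-, hN, -, rfl⟩ | ⟨-, hN, -, rfl⟩ <;> nlinarith

/-- A weighted graph in which every vertex misses little or is rigid is a clique. -/
theorem isClique_of_good_or_rigid [DecidableEq V] (hw : ∀ v, 0 ≤ w v) (hs : 0 < s) (hr : 2 ≤ r) (hrk : r ≤ k)
    (star : ∀ T ⊆ U, G.IsClique (T : Set V) → T.card = k - 1 →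
      ∀ x ∈ commonNbrs G U T, ∀ y ∈ commonNbrs G U T, x = y)
    (hreg : (4 * (r : ℝ) ≤ 3 * k + 2 ∧ ∑ v ∈ U, w v = (3 * k - 2) * s ∧
        δ = (3 * k - 3 * r + 1) * s ∧ g = 3 * s) ∨
      (3 * (k : ℝ) + 2 ≤ 4 * r ∧ ∑ v ∈ U, w v = (k + 2) * s ∧
        δ = ((k : ℝ) - r + 1) * s ∧ g = s))
    (hdich : ∀ v ∈ U, ∑ u ∈ U, w u - ∑ u ∈ commonNbrs G U {v}, w u < g ∨ Rigid G U w k r δ v) :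
    G.IsClique (U : Set V) ∧ U.card = k := by
  have hrR : (2 : ℝ) ≤ r := by exact_mod_cast hr
  have hrkR : (r : ℝ) ≤ k := by exact_mod_cast hrk
  have hg0 : 0 < g := by rcases hreg with ⟨-, -, -, rfl⟩ | ⟨-, -, -, rfl⟩ <;> linarith
  have hcardle : ∀ T ⊆ U, G.IsClique (T : Set V) → T.card ≤ k := fun T hTU hT =>
    card_le_of_star (by omega) star hTU hT
  by_cases hloose : ∃ T ⊆ U, G.IsClique (T : Set V) ∧ ¬ G.IsClique (commonNbrs G U T : Set V)
  swap
  · push Not at hloose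
    have hU : G.IsClique (U : Set V) := by
      have := hloose ∅ (Finset.empty_subset _) (by simp)
      rwa [commonNbrs_empty] at this
    refine ⟨hU, le_antisymm (hcardle U subset_rfl hU) ?_⟩
    by_contra hcon
    by_cases hrig : ∃ v ∈ U, Rigid G U w k r δ v
    · obtain ⟨v, hv, hR⟩ := hrig
      have hsub : commonNbrs G U {v} ⊆ U.erase v := fun u hu => by
        rw [mem_commonNbrs_singleton] at hu
        exact Finset.mem_erase.mpr ⟨hu.2.ne', hu.1⟩
      have := Finset.card_le_card hsub
      rw [hR.2.1, Finset.card_erase_of_mem hv] at this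
      have := Finset.card_pos.mpr ⟨v, hv⟩
      omega
    · push Not at hrig
      obtain ⟨x, hx⟩ := commonNbrs_nonempty_of_good hw hs hreg
        (fun t ht => (hdich t ht).resolve_right (hrig t ht)) (not_le.mp hcon)
      exact notMem_of_mem_commonNbrs hx (commonNbrs_subset hx)
  exfalso
  obtain ⟨T, ⟨hTU, hTcl, hTloose⟩, hTmax⟩ : ∃ T : Finset V,
      (T ⊆ U ∧ G.IsClique (T : Set V) ∧ ¬ G.IsClique (commonNbrs G U T : Set V)) ∧
      ∀ T' : Finset V, T' ⊆ U → G.IsClique (T' : Set V) →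
        ¬ G.IsClique (commonNbrs G U T' : Set V) → T'.card ≤ T.card := by
    classical
    obtain ⟨T₁, h₁⟩ := hloose
    obtain ⟨T, hT, hmax⟩ := Finset.exists_max_image
      (U.powerset.filter fun T : Finset V => G.IsClique (T : Set V) ∧
        ¬ G.IsClique (commonNbrs G U T : Set V)) Finset.card
      ⟨T₁, Finset.mem_filter.mpr ⟨Finset.mem_powerset.mpr h₁.1, h₁.2⟩⟩
    rw [Finset.mem_filter, Finset.mem_powerset] at hT
    exact ⟨T, hT, fun T' h1 h2 h3 => hmax T'
      (Finset.mem_filter.mpr ⟨Finset.mem_powerset.mpr h1, h2, h3⟩)⟩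
  have hmax : ∀ c ∈ commonNbrs G U T, G.IsClique (commonNbrs G U (insert c T) : Set V) := by
    intro c hc
    by_contra hcon
    have := hTmax (insert c T) (Finset.insert_subset (commonNbrs_subset hc) hTU)
      (isClique_insert_of_mem hTcl hc) hcon
    rw [Finset.card_insert_of_notMem (notMem_of_mem_commonNbrs hc)] at this
    omega
  -- A rigid `t` would confine the common neighbourhood of `T` to a clique.
  have hTgood : ∀ t ∈ T, ∑ v ∈ U, w v - ∑ v ∈ commonNbrs G U {t}, w v < g := fun t ht =>
    (hdich t (hTU ht)).resolve_right fun hR => hTloose (hR.1.subset (by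
      exact_mod_cast commonNbrs_anti (Finset.singleton_subset_iff.mpr ht)))
  set Y := commonNbrs G U T with hYdef
  set K : V → Finset V := fun c => insert c (commonNbrs G U (insert c T)) with hKdef
  have hKY : ∀ c ∈ Y, K c ⊆ Y := fun c hc =>
    Finset.insert_subset hc (commonNbrs_anti (Finset.subset_insert c T))
  have hcK : ∀ c, c ∈ K c := fun c => Finset.mem_insert_self _ _
  have hKcl : ∀ c ∈ Y, G.IsClique (K c : Set V) := fun c hc => by
    refine isClique_insert_of_mem (U := U) (hmax c hc) (mem_commonNbrs.mpr
      ⟨commonNbrs_subset hc, fun t ht => ?_⟩)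
    exact ((mem_commonNbrs_insert.mp ht).2).symm
  have hKadj : ∀ c ∈ Y, ∀ d ∈ K c, ∀ z ∈ Y, G.Adj d z → z ∈ K c := fun c hc d hd z hz hdz =>
    mem_insert_commonNbrs_of_adj hmax hd hz hc hdz
  have hTK : ∀ c ∈ Y, Disjoint T (K c) := fun c hc => by
    rw [Finset.disjoint_right]
    exact fun v hv => notMem_of_mem_commonNbrs (hKY c hc hv)
  have hnb : ∀ c ∈ Y, ∀ a ∈ K c, Rigid G U w k r δ a →
      commonNbrs G U {a} = T ∪ (K c).erase a := fun c hc a ha hR =>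
    commonNbrs_singleton_eq hmax hTU hc (hKcl c hc) (hKY c hc) ha hR.1
  -- A rigid vertex of `K c` fixes the size, its neighbourhood being `T ∪ (K c).erase a`. If there
  -- is none, all of `T ∪ K c` is good, and with fewer than `k` vertices it would have a further
  -- common neighbour, which would belong to `K c`.
  have hKcard : ∀ c ∈ Y, T.card + (K c).card = k := by
    intro c hc
    rw [← Finset.card_union_of_disjoint (hTK c hc)]
    have hsubU : T ∪ K c ⊆ U := Finset.union_subset hTU ((hKY c hc).trans commonNbrs_subset)
    have hcl : G.IsClique ((T ∪ K c : Finset V) : Set V) := by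
      intro x hx y hy hxy
      rw [mem_coe, Finset.mem_union] at hx hy
      rcases hx with hx | hx <;> rcases hy with hy | hy
      · exact hTcl hx hy hxy
      · exact (mem_commonNbrs.mp (hKY c hc hy)).2 x hx
      · exact ((mem_commonNbrs.mp (hKY c hc hx)).2 y hy).symm
      · exact hKcl c hc hx hy hxy
    refine le_antisymm (hcardle _ hsubU hcl) ?_
    by_contra hcon
    by_cases hrig : ∃ a ∈ K c, Rigid G U w k r δ a
    · obtain ⟨a, ha, hR⟩ := hrig
      have h1 := hR.2.1
      rw [hnb c hc a ha hR, Finset.card_union_of_disjoint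
        ((hTK c hc).mono_right (Finset.erase_subset _ _)), Finset.card_erase_of_mem ha] at h1
      rw [Finset.card_union_of_disjoint (hTK c hc)] at hcon
      have := Finset.card_pos.mpr ⟨a, ha⟩
      omega
    · push Not at hrig
      obtain ⟨x, hx⟩ := commonNbrs_nonempty_of_good (G := G) hw hs hreg (T := T ∪ K c)
        (fun t ht => by
          rcases Finset.mem_union.mp ht with h | h
          · exact hTgood t h
          · exact (hdich t (hsubU ht)).resolve_right (hrig t h)) (not_le.mp hcon)
      have hxY : x ∈ Y := commonNbrs_anti Finset.subset_union_left hx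
      refine notMem_of_mem_commonNbrs hx (Finset.mem_union_right _ ?_)
      exact hKadj c hc c (hcK c) x hxY
        ((mem_commonNbrs.mp hx).2 c (Finset.mem_union_right _ (hcK c)))
  obtain ⟨y₁, hy₁, y₂, hy₂, hne, hnadj⟩ : ∃ y₁ ∈ Y, ∃ y₂ ∈ Y, y₁ ≠ y₂ ∧ ¬ G.Adj y₁ y₂ := by
    by_contra hcon
    push Not at hcon
    exact hTloose fun x hx y hy hxy => hcon x hx y hy hxy
  have hKdisj : Disjoint (K y₁) (K y₂) := by
    rw [Finset.disjoint_left]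
    intro z hz1 hz2
    have h2 : y₂ ∈ K y₁ := by
      by_cases hzy : z = y₂
      · exact hzy ▸ hz1
      · exact hKadj y₁ hy₁ z hz1 y₂ hy₂ (hKcl y₂ hy₂ hz2 (hcK y₂) hzy)
    exact hnadj (hKcl y₁ hy₁ (hcK y₁) h2 hne)
  have hTcard : T.card + 2 ≤ k := by
    by_contra hcon
    obtain ⟨T₀, hT₀, hcard⟩ := Finset.exists_subset_card_eq (show k - 1 ≤ T.card by omega)
    exact hne (star T₀ (hT₀.trans hTU) (hTcl.subset (by exact_mod_cast hT₀)) hcard _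
      (commonNbrs_anti hT₀ hy₁) _ (commonNbrs_anti hT₀ hy₂))
  set N := ∑ v ∈ U, w v with hN
  obtain ⟨t, ht⟩ : ∃ t : ℝ, t = T.card := ⟨_, rfl⟩
  have ht0 : 0 ≤ t := by rw [ht]; positivity
  have ht2 : t + 2 ≤ k := by rw [ht]; exact_mod_cast hTcard
  have hKcardR : ∀ c ∈ Y, ((K c).card : ℝ) = k - t := fun c hc => by
    rw [ht, eq_sub_iff_add_eq']
    exact_mod_cast hKcard c hc
  have hNY : N - ∑ v ∈ Y, w v ≤ t * g := by
    refine (sum_sub_sum_commonNbrs_le hw T).trans ?_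
    rw [ht, ← nsmul_eq_mul]
    exact Finset.sum_le_card_nsmul _ _ _ fun u hu => (hTgood u hu).le
  have hWTY : ∑ v ∈ T, w v + ∑ v ∈ Y, w v ≤ N := by
    have hdisj : Disjoint T Y := by
      rw [Finset.disjoint_right]
      exact fun v hv => notMem_of_mem_commonNbrs hv
    rw [← Finset.sum_union hdisj]
    exact Finset.sum_le_sum_of_subset_of_nonneg
      (Finset.union_subset hTU commonNbrs_subset) fun v _ _ => hw v
  have hWT0 : 0 ≤ ∑ v ∈ T, w v := Finset.sum_nonneg fun v _ => hw v
  -- The loss `N - w(Y)` averaged over `T`, which also bounds the average weight of `T`; for empty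
  -- `T` any value would satisfy the equation, and `0` is taken.
  obtain ⟨τ, hτ0, hτg, htτ⟩ : ∃ τ : ℝ, 0 ≤ τ ∧ τ ≤ g ∧ t * τ = N - ∑ v ∈ Y, w v := by
    rcases ht0.eq_or_lt with h | h
    · refine ⟨0, le_rfl, hg0.le, ?_⟩
      rw [← h] at hNY
      linarith
    · refine ⟨(N - ∑ v ∈ Y, w v) / t, div_nonneg (by linarith) h.le, ?_, by field_simp⟩
      rw [div_le_iff₀ h]
      linarith
  have hWKK : ∑ v ∈ K y₁, w v + ∑ v ∈ K y₂, w v ≤ ∑ v ∈ Y, w v := by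
    rw [← Finset.sum_union hKdisj]
    exact Finset.sum_le_sum_of_subset_of_nonneg
      (Finset.union_subset (hKY y₁ hy₁) (hKY y₂ hy₂)) fun v _ _ => hw v
  have hgoodK : ∀ c ∈ Y, ∀ a ∈ K c, N - ∑ v ∈ commonNbrs G U {a}, w v < g →
      ∑ v ∈ Y, w v - ∑ v ∈ K c, w v + w a < g := fun c hc a ha h =>
    sum_sub_lt_of_good hw commonNbrs_subset (commonNbrs_subset (hKY c hc ha)) ha
      (hKadj c hc a ha) (hKY c hc) h
  have htwo : ∀ c ∈ Y, ∀ a ∈ K c, Rigid G U w k r δ a → ∀ α β : ℝ, 0 ≤ α → α ≤ 1 → 0 ≤ β →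
      β ≤ 1 → α * t + β * (k - t - 1) = (k : ℝ) - r + 1 →
      δ < α * (t * τ) + β * (∑ v ∈ K c, w v - w a) := by
    intro c hc a ha hR α β h1 h2 h3 h4 h5
    have := hR.lt_two_values (hTK c hc) (hnb c hc a ha hR) ha h1 h2 h3 h4
      (by rw [hKcardR c hc, ← ht]; exact h5)
    have h6 : α * ∑ v ∈ T, w v ≤ α * (t * τ) := mul_le_mul_of_nonneg_left (by linarith) h1
    linarith
  -- The only case in which `2g ≤ w(Y)` can fail: here `w(Y)` is only known to be at least `4s`,
  -- while `2g = 6s`.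
  by_cases hpair : 4 * (r : ℝ) ≤ 3 * k + 2 ∧ N = (3 * k - 2) * s ∧
        δ = (3 * k - 3 * r + 1) * s ∧ g = 3 * s ∧ t + 2 = k
  · obtain ⟨h1, h2, h3, h4, h5⟩ := hpair
    have hsingle : ∀ c ∈ Y, ∀ a ∈ K c, δ < ∑ v ∈ K c, w v - w a + (k - r) * τ := by
      intro c hc a ha
      rcases hdich a (commonNbrs_subset (hKY c hc ha)) with hgd | hR
      · have e1 := hgoodK c hc a ha hgd
        have e2 : ((r : ℝ) - 2) * τ ≤ (r - 2) * g := mul_le_mul_of_nonneg_left hτg (by linarith)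
        have e3 : t = k - 2 := by linarith
        rw [e3] at htτ
        rw [h3]
        rw [h4] at e1 e2
        linarith
      · rcases ht0.eq_or_lt with h | h
        · have := htwo c hc a ha hR 0 1 le_rfl zero_le_one zero_le_one le_rfl (by linarith)
          have e : (0 : ℝ) ≤ (k - r) * τ := mul_nonneg (by linarith) hτ0
          linarith
        · have := htwo c hc a ha hR (((k : ℝ) - r) / t) 1 (div_nonneg (by linarith) ht0)
            (by rw [div_le_one h]; linarith) zero_le_one le_rfl
            (by rw [div_mul_cancel₀ _ h.ne']; linarith)
          rw [← mul_assoc, div_mul_cancel₀ _ h.ne'] at this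
          linarith
    have hdouble : ∀ c ∈ Y, 2 * δ < ∑ v ∈ K c, w v + 2 * (k - r) * τ := by
      intro c hc
      have hc2 : (K c).card = 2 := by
        have : ((K c).card : ℝ) = 2 := by rw [hKcardR c hc]; linarith
        exact_mod_cast this
      obtain ⟨a, b, hab, hKab⟩ := Finset.card_eq_two.mp hc2
      have e1 := hsingle c hc a (by simp [hKab])
      have e2 := hsingle c hc b (by simp [hKab])
      rw [hKab, Finset.sum_pair hab] at e1 e2 ⊢
      linarith
    refine pair_contradiction (K := k) (R := r) h1 h2 h3 (hτg.trans h4.le) ?_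
      (hdouble y₁ hy₁) (hdouble y₂ hy₂)
    have e3 : t = k - 2 := by linarith
    rw [e3] at htτ
    linarith
  · have hYbig : 2 * g ≤ ∑ v ∈ Y, w v := by
      rcases hreg with ⟨h1, h2, h3, h4⟩ | ⟨h1, h2, h3, h4⟩
      · have ht3 : t + 3 ≤ k := by
          have hlt : T.card + 2 ≠ k := fun h => hpair ⟨h1, h2, h3, h4, by
            rw [ht]; exact_mod_cast h⟩
          have : T.card + 3 ≤ k := by omega
          rw [ht]
          exact_mod_cast this
        have := mul_le_mul_of_nonneg_right ht3 hs.le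
        rw [h4] at hNY ⊢
        linarith
      · have := mul_le_mul_of_nonneg_right ht2 hs.le
        rw [h4] at hNY ⊢
        linarith
    -- A component with a good vertex has all but less than `g` of the weight of `Y`. As `2g ≤
    -- w(Y)`, at most one of two disjoint components is like that, and then the other has less than
    -- half.
    obtain ⟨c, hc, hcR, hcW⟩ : ∃ c ∈ Y, (∀ a ∈ K c, Rigid G U w k r δ a) ∧
        2 * ∑ v ∈ K c, w v ≤ ∑ v ∈ Y, w v := by
      have key : ∀ c ∈ Y, (∀ a ∈ K c, Rigid G U w k r δ a) ∨
          ∑ v ∈ Y, w v - ∑ v ∈ K c, w v < g := by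
        intro c hc
        by_contra hcon
        push Not at hcon
        obtain ⟨⟨a, ha, hR⟩, hge⟩ := hcon
        have := hgoodK c hc a ha
          ((hdich a (commonNbrs_subset (hKY c hc ha))).resolve_right hR)
        linarith [hw a]
      rcases key y₁ hy₁ with h1 | h1 <;> rcases key y₂ hy₂ with h2 | h2
      · rcases le_total (∑ v ∈ K y₁, w v) (∑ v ∈ K y₂, w v) with h | h
        · exact ⟨y₁, hy₁, h1, by linarith⟩
        · exact ⟨y₂, hy₂, h2, by linarith⟩
      · exact ⟨y₁, hy₁, h1, by linarith⟩
      · exact ⟨y₂, hy₂, h2, by linarith⟩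
      · linarith
    obtain ⟨J, hJ⟩ : ∃ J : ℝ, J = k - t := ⟨_, rfl⟩
    have hJ2 : 2 ≤ J := by linarith
    have hJ0 : J ≠ 0 := by linarith
    obtain ⟨η, hη⟩ : ∃ η, J * η = ∑ v ∈ K c, w v := ⟨(∑ v ∈ K c, w v) / J, by field_simp⟩
    -- With `a` at least average, the rest of its component weighs at most `(J - 1)η`.
    obtain ⟨a, ha, haη⟩ : ∃ a ∈ K c, η ≤ w a := by
      refine Finset.exists_le_of_sum_le ⟨c, hcK c⟩ ?_
      rw [Finset.sum_const, nsmul_eq_mul, hKcardR c hc, ← hJ, hη]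
    have hta : t = k - J := by linarith
    have hrest : ∑ v ∈ K c, w v - w a ≤ (J - 1) * η := by linarith
    have htwo' := htwo c hc a ha (hcR a ha)
    -- The three coefficient choices at `a`: constant on all neighbours; `1` on the rest of `K c`
    -- with the remainder spread over `T`; everything spread over the rest of `K c`.
    refine average_contradiction (K := k) (R := r) (J := J) (s := s) (τ := τ) (η := η) (N := N)
      (δ := δ) hrkR hJ2 hs ?_ ?_ ?_ ?_ ?_
    · rw [← hta]
      linarith
    · have hk1 : (0 : ℝ) < k - 1 := by linarith
      have h := htwo' (((k : ℝ) - r + 1) / (k - 1)) (((k : ℝ) - r + 1) / (k - 1))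
        (div_nonneg (by linarith) hk1.le) (by rw [div_le_one hk1]; linarith)
        (div_nonneg (by linarith) hk1.le) (by rw [div_le_one hk1]; linarith)
        (by field_simp; ring)
      rw [← mul_add, div_mul_eq_mul_div, lt_div_iff₀ hk1] at h
      have h' : ((k : ℝ) - r + 1) * (t * τ + (∑ v ∈ K c, w v - w a)) ≤
          (k - r + 1) * (t * τ + (J - 1) * η) := mul_le_mul_of_nonneg_left (by linarith)
            (by linarith)
      rw [← hta]
      linarith
    · intro hle
      rcases ht0.eq_or_lt with h | h
      · have := htwo' 0 1 le_rfl zero_le_one zero_le_one le_rfl (by linarith)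
        have e : (0 : ℝ) ≤ (k - r + 1 - (J - 1)) * τ := mul_nonneg (by linarith) hτ0
        linarith
      · have := htwo' (((k : ℝ) - r + 1 - (J - 1)) / t) 1 (div_nonneg (by linarith) ht0)
          (by rw [div_le_one h]; linarith) zero_le_one le_rfl
          (by rw [div_mul_cancel₀ _ h.ne']; linarith)
        rw [← mul_assoc, div_mul_cancel₀ _ h.ne'] at this
        linarith
    · intro hlt
      have hJ1 : (0 : ℝ) < J - 1 := by linarith
      have h := htwo' 0 (((k : ℝ) - r + 1) / (J - 1)) le_rfl zero_le_one
        (div_nonneg (by linarith) hJ1.le) (by rw [div_le_one hJ1]; linarith)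
        (by rw [← hJ]; field_simp; ring)
      have h' : ((k : ℝ) - r + 1) / (J - 1) * (∑ v ∈ K c, w v - w a) ≤
          ((k : ℝ) - r + 1) / (J - 1) * ((J - 1) * η) :=
        mul_le_mul_of_nonneg_left hrest (div_nonneg (by linarith) hJ1.le)
      rw [← mul_assoc, div_mul_cancel₀ _ hJ1.ne'] at h'
      linarith
    · rcases hreg with ⟨h1, h2, h3, h4⟩ | ⟨h1, h2, h3, h4⟩
      · exact Or.inl ⟨h1, h2, h3, hτg.trans h4.le⟩
      · exact Or.inr ⟨h1, h2, h3, hτg.trans h4.le⟩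

end RigidGraphs

/-! ### Uniform families, their links and weighted codegrees -/

section Links

variable {V : Type*} {E : Finset (Finset V)} {w : V → ℝ} {k r : ℕ} {δ : ℝ}
  {a u v : V}

/-- Two distinct vertices are adjacent if they lie in a common member of the family. -/
def coGraph (E : Finset (Finset V)) : SimpleGraph V where
  Adj u v := u ≠ v ∧ ∃ e ∈ E, u ∈ e ∧ v ∈ e
  symm := ⟨fun _ _ h => ⟨h.1.symm, h.2.imp fun _ he => ⟨he.1, he.2.2, he.2.1⟩⟩⟩
  loopless := ⟨fun _ h => h.1 rfl⟩

theorem coGraph_adj : (coGraph E).Adj u v ↔ u ≠ v ∧ ∃ e ∈ E, u ∈ e ∧ v ∈ e := Iff.rfl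

variable [DecidableEq V]

/-- The vertices that lie in a member of the family. -/
def vertexSet (E : Finset (Finset V)) : Finset V :=
  E.biUnion id

/-- The vertices that extend `S` to a member of the family. -/
def extenders (E : Finset (Finset V)) (S : Finset V) : Finset V :=
  (vertexSet E).filter fun u => insert u S ∈ E

/-- The link of a vertex. -/
def linkFamily (E : Finset (Finset V)) (c : V) : Finset (Finset V) :=
  (E.filter fun e => c ∈ e).image fun e => e.erase c

theorem mem_vertexSet : v ∈ vertexSet E ↔ ∃ e ∈ E, v ∈ e := by
  simp [vertexSet]

theorem mem_extenders {S : Finset V} : u ∈ extenders E S ↔ insert u S ∈ E := by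
  rw [extenders, Finset.mem_filter, and_iff_right_iff_imp]
  exact fun h => mem_vertexSet.mpr ⟨_, h, Finset.mem_insert_self _ _⟩

theorem mem_linkFamily {e : Finset V} : e ∈ linkFamily E a ↔ a ∉ e ∧ insert a e ∈ E := by
  simp only [linkFamily, Finset.mem_image, Finset.mem_filter]
  constructor
  · rintro ⟨f, ⟨hf, ha⟩, rfl⟩
    exact ⟨Finset.notMem_erase a f, by rwa [Finset.insert_erase ha]⟩
  · rintro ⟨ha, he⟩
    exact ⟨_, ⟨he, Finset.mem_insert_self _ _⟩, Finset.erase_insert ha⟩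

theorem notMem_of_mem_extenders {e : Finset V} (hE : (E : Set (Finset V)).Sized r)
    (he : e ∈ E) (hv : v ∈ e) (hu : u ∈ extenders E (e.erase v)) : u ∉ e.erase v := by
  intro h
  have h1 := hE (mem_extenders.mp hu)
  rw [Finset.insert_eq_of_mem h, Finset.card_erase_of_mem hv, hE he] at h1
  have := Finset.card_pos.mpr ⟨v, hv⟩
  rw [hE he] at this
  omega

theorem mem_commonNbrs_coGraph : u ∈ commonNbrs (coGraph E) (vertexSet E) {a} ↔
    u ≠ a ∧ ∃ e ∈ E, a ∈ e ∧ u ∈ e := by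
  rw [mem_commonNbrs_singleton, coGraph_adj]
  constructor
  · rintro ⟨-, h, h'⟩
    exact ⟨h.symm, h'⟩
  · rintro ⟨h, e, he, hae, hue⟩
    exact ⟨mem_vertexSet.mpr ⟨e, he, hue⟩, h.symm, e, he, hae, hue⟩

/-- An exchange argument: take a heaviest edge `e` through `a` and its lightest other vertex `x`.
Extenders of `e.erase x` weigh at most `w x`, and the remaining `r - 2` vertices `Q` at least `w x`.
Hence no fractional choice of total `k - r + 1` is lighter than the extenders. -/
theorem lt_sum_mul_of_card_commonNbrs (hr : 2 ≤ r) (hrk : r ≤ k)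
    (hE : (E : Set (Finset V)).Sized r) (hw : ∀ v, 0 ≤ w v)
    (hcod : ∀ e ∈ E, ∀ v ∈ e, δ < ∑ u ∈ extenders E (e.erase v), w u)
    (ha : a ∈ vertexSet E) (hcard : (commonNbrs (coGraph E) (vertexSet E) {a}).card = k - 1)
    {c : V → ℝ} (hc0 : ∀ u, 0 ≤ c u) (hc1 : ∀ u, c u ≤ 1)
    (hc : ∑ u ∈ commonNbrs (coGraph E) (vertexSet E) {a}, c u = (k : ℝ) - r + 1) :
    δ < ∑ u ∈ commonNbrs (coGraph E) (vertexSet E) {a}, c u * w u := by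
  set Z := commonNbrs (coGraph E) (vertexSet E) {a} with hZ
  obtain ⟨e₁, he₁, hae₁⟩ := mem_vertexSet.mp ha
  obtain ⟨e, he, hemax⟩ := Finset.exists_max_image (E.filter fun e => a ∈ e)
    (fun e => ∑ v ∈ e, w v) ⟨e₁, Finset.mem_filter.mpr ⟨he₁, hae₁⟩⟩
  rw [Finset.mem_filter] at he
  obtain ⟨he, hae⟩ := he
  have hecard : e.card = r := hE he
  have hne : (e.erase a).Nonempty := by
    rw [← Finset.card_pos, Finset.card_erase_of_mem hae, hecard]
    omega
  obtain ⟨x, hx, hxmin⟩ := Finset.exists_min_image (e.erase a) w hne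
  rw [Finset.mem_erase] at hx
  have haS : a ∈ e.erase x := Finset.mem_erase.mpr ⟨hx.1.symm, hae⟩
  set P := extenders E (e.erase x) with hP
  set Q := (e.erase x).erase a with hQ
  have hQcard : Q.card = r - 2 := by
    rw [hQ, Finset.card_erase_of_mem haS, Finset.card_erase_of_mem hx.2, hecard]
    omega
  have hQZ : Q ⊆ Z := fun z hz => by
    rw [hQ, Finset.mem_erase, Finset.mem_erase] at hz
    exact mem_commonNbrs_coGraph.mpr ⟨hz.1, e, he, hae, hz.2.2⟩
  have hPS : ∀ p ∈ P, p ∉ e.erase x := fun p hp => notMem_of_mem_extenders hE he hx.2 hp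
  have hPQ : ∀ p ∈ P, p ∉ Q := fun p hp h => hPS p hp (Finset.mem_of_mem_erase h)
  have hPZ : P ⊆ Z := fun p hp => mem_commonNbrs_coGraph.mpr
    ⟨fun h => hPS p hp (h ▸ haS), _, mem_extenders.mp hp, Finset.mem_insert_of_mem haS,
      Finset.mem_insert_self _ _⟩
  have hPw : ∀ p ∈ P, w p ≤ w x := fun p hp => by
    have h := hemax _ (Finset.mem_filter.mpr ⟨mem_extenders.mp hp, Finset.mem_insert_of_mem haS⟩)
    rw [Finset.sum_insert (hPS p hp), ← Finset.add_sum_erase e w hx.2] at h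
    linarith
  have hQw : ∀ z ∈ Q, w x ≤ w z := fun z hz => by
    rw [hQ, Finset.mem_erase, Finset.mem_erase] at hz
    exact hxmin z (Finset.mem_erase.mpr ⟨hz.1, hz.2.2⟩)
  have hsumP : ∑ u ∈ P, w u = ∑ u ∈ Z, if u ∈ P then w u else 0 := by
    rw [Finset.sum_ite_mem, Finset.inter_eq_right.mpr hPZ]
  have hsumQ : ∑ u ∈ Z, (if u ∈ Q then (0 : ℝ) else 1) = (k : ℝ) - r + 1 := by
    have h1 : ∑ u ∈ Z, (if u ∈ Q then (1 : ℝ) else 0) = (r : ℝ) - 2 := by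
      rw [Finset.sum_ite_mem, Finset.inter_eq_right.mpr hQZ, Finset.sum_const, hQcard,
        nsmul_eq_mul, mul_one, Nat.cast_sub hr]
      norm_num
    have h2 : ∑ u ∈ Z, ((if u ∈ Q then (0 : ℝ) else 1) + if u ∈ Q then 1 else 0) = k - 1 := by
      rw [Finset.sum_congr rfl (g := fun _ => (1 : ℝ)) (fun u _ => by split_ifs <;> norm_num),
        Finset.sum_const, hcard, nsmul_eq_mul, mul_one, Nat.cast_sub (by omega)]
      norm_num
    rw [Finset.sum_add_distrib, h1] at h2
    linarith
  -- The left side vanishes, because `Z` has exactly `k - r + 1` elements outside `Q`, the total of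
  -- `c`.
  have hpt : ∑ u ∈ Z, w x * (c u - if u ∈ Q then 0 else 1) ≤
      ∑ u ∈ Z, (c u * w u - if u ∈ P then w u else 0) := by
    refine Finset.sum_le_sum fun u _ => ?_
    by_cases hQu : u ∈ Q
    · rw [if_pos hQu, if_neg fun h => hPQ u h hQu]
      have := mul_le_mul_of_nonneg_left (hQw u hQu) (hc0 u)
      linarith
    · rw [if_neg hQu]
      have h1 := mul_nonneg (hc0 u) (hw u)
      by_cases hPu : u ∈ P
      · rw [if_pos hPu]
        nlinarith [hPw u hPu, hc1 u]
      · rw [if_neg hPu]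
        nlinarith [hw x, hc1 u]
  rw [← Finset.mul_sum, Finset.sum_sub_distrib, Finset.sum_sub_distrib, hsumQ, hc, ← hsumP] at hpt
  have := hcod e he x hx.2
  linarith

theorem sized_linkFamily (hE : (E : Set (Finset V)).Sized r) :
    (linkFamily E a : Set (Finset V)).Sized (r - 1) := fun e he => by
  obtain ⟨ha, he⟩ := mem_linkFamily.mp he
  have := hE he
  rw [Finset.card_insert_of_notMem ha] at this
  omega

theorem vertexSet_linkFamily :
    vertexSet (linkFamily E a) = commonNbrs (coGraph E) (vertexSet E) {a} := by
  ext u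
  rw [mem_vertexSet, mem_commonNbrs_coGraph]
  constructor
  · rintro ⟨e, he, hu⟩
    obtain ⟨ha, he⟩ := mem_linkFamily.mp he
    exact ⟨fun h => ha (h ▸ hu), _, he, Finset.mem_insert_self _ _, Finset.mem_insert_of_mem hu⟩
  · rintro ⟨hua, e, he, hae, hue⟩
    exact ⟨e.erase a, mem_linkFamily.mpr ⟨Finset.notMem_erase _ _, by rwa [Finset.insert_erase hae]⟩,
      Finset.mem_erase.mpr ⟨hua, hue⟩⟩

theorem coGraph_linkFamily_le : coGraph (linkFamily E a) ≤ coGraph E := by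
  rintro u v ⟨huv, e, he, hu, hv⟩
  exact ⟨huv, _, (mem_linkFamily.mp he).2, Finset.mem_insert_of_mem hu,
    Finset.mem_insert_of_mem hv⟩

/-- Whatever extends a set containing `a` in the family also extends that set without `a` in the
link, so no codegree is lost. -/
theorem lt_sum_extenders_linkFamily (hE : (E : Set (Finset V)).Sized r) (hw : ∀ v, 0 ≤ w v)
    (hcod : ∀ e ∈ E, ∀ v ∈ e, δ < ∑ u ∈ extenders E (e.erase v), w u) :
    ∀ e ∈ linkFamily E a, ∀ v ∈ e, δ < ∑ u ∈ extenders (linkFamily E a) (e.erase v), w u := by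
  intro e he v hv
  obtain ⟨hae, he⟩ := mem_linkFamily.mp he
  have hva : v ≠ a := fun h => hae (h ▸ hv)
  refine (hcod _ he v (Finset.mem_insert_of_mem hv)).trans_le
    (Finset.sum_le_sum_of_subset_of_nonneg (fun u hu => ?_) fun u _ _ => hw u)
  have hu' := notMem_of_mem_extenders hE he (Finset.mem_insert_of_mem hv) hu
  rw [mem_extenders] at hu
  rw [Finset.erase_insert_of_ne hva.symm] at hu hu'
  rw [Finset.mem_insert, not_or] at hu'
  refine mem_extenders.mpr (mem_linkFamily.mpr ⟨?_, by rwa [Finset.insert_comm]⟩)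
  rw [Finset.mem_insert, not_or]
  exact ⟨Ne.symm hu'.1, fun h => hae (Finset.mem_of_mem_erase h)⟩

/-- Adding `a` turns a clique of `k - 2` vertices in the link into one of `k - 1` in the family,
with the same common neighbours. -/
theorem star_linkFamily (hk : 2 ≤ k)
    (star : ∀ T ⊆ vertexSet E, (coGraph E).IsClique (T : Set V) → T.card = k - 1 →
      ∀ x ∈ commonNbrs (coGraph E) (vertexSet E) T,
      ∀ y ∈ commonNbrs (coGraph E) (vertexSet E) T, x = y) (ha : a ∈ vertexSet E) :
    ∀ T ⊆ vertexSet (linkFamily E a), (coGraph (linkFamily E a)).IsClique (T : Set V) →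
      T.card = k - 1 - 1 →
      ∀ x ∈ commonNbrs (coGraph (linkFamily E a)) (vertexSet (linkFamily E a)) T,
      ∀ y ∈ commonNbrs (coGraph (linkFamily E a)) (vertexSet (linkFamily E a)) T, x = y := by
  intro T hT hTcl hTcard x hx y hy
  rw [vertexSet_linkFamily] at hT hx hy
  have haT : a ∉ T := fun h => (mem_commonNbrs_coGraph.mp (hT h)).1 rfl
  have key : ∀ z ∈ commonNbrs (coGraph (linkFamily E a))
      (commonNbrs (coGraph E) (vertexSet E) {a}) T,
      z ∈ commonNbrs (coGraph E) (vertexSet E) (insert a T) := fun z hz => by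
    rw [mem_commonNbrs] at hz
    refine mem_commonNbrs_insert.mpr ⟨mem_commonNbrs.mpr ⟨commonNbrs_subset hz.1, fun t ht =>
      coGraph_linkFamily_le (hz.2 t ht)⟩, (mem_commonNbrs_singleton.mp hz.1).2⟩
  refine star (insert a T) (Finset.insert_subset ha (hT.trans commonNbrs_subset)) ?_ ?_ x
    (key x hx) y (key y hy)
  · rw [Finset.coe_insert, SimpleGraph.isClique_insert]
    exact ⟨hTcl.mono coGraph_linkFamily_le, fun t ht _ =>
      (mem_commonNbrs_singleton.mp (hT ht)).2⟩
  · rw [Finset.card_insert_of_notMem haT, hTcard]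
    omega

end Links

/-! ### Induction on uniformity -/

section WeightedFamilies

variable {V : Type*} [DecidableEq V] {E : Finset (Finset V)} {w : V → ℝ} {k r : ℕ} {δ g : ℝ}

/-- The induction step with the induction hypothesis abstracted into `hlink`: non-good vertices
become rigid by the exchange argument. -/
theorem isClique_of_link (hr : 2 ≤ r) (hrk : r ≤ k)
    (hEne : E.Nonempty) (hE : (E : Set (Finset V)).Sized r) (hw : ∀ v, 0 ≤ w v)
    (hcod : ∀ e ∈ E, ∀ v ∈ e, δ < ∑ u ∈ extenders E (e.erase v), w u)
    (star : ∀ T ⊆ vertexSet E, (coGraph E).IsClique (T : Set V) → T.card = k - 1 →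
      ∀ x ∈ commonNbrs (coGraph E) (vertexSet E) T,
      ∀ y ∈ commonNbrs (coGraph E) (vertexSet E) T, x = y)
    (hreg : (4 * (r : ℝ) ≤ 3 * k + 2 ∧ g = 3 * ((∑ v ∈ vertexSet E, w v) / (3 * k - 2)) ∧
        (3 * (k : ℝ) - 3 * r + 1) * ∑ v ∈ vertexSet E, w v ≤ (3 * k - 2) * δ) ∨
      (3 * (k : ℝ) + 2 ≤ 4 * r ∧ g = (∑ v ∈ vertexSet E, w v) / (k + 2) ∧
        ((k : ℝ) - r + 1) * ∑ v ∈ vertexSet E, w v ≤ (k + 2) * δ))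
    (hlink : ∀ v ∈ vertexSet E,
      g ≤ ∑ u ∈ vertexSet E, w u - ∑ u ∈ commonNbrs (coGraph E) (vertexSet E) {v}, w u →
      (coGraph E).IsClique (commonNbrs (coGraph E) (vertexSet E) {v} : Set V) ∧
        (commonNbrs (coGraph E) (vertexSet E) {v}).card = k - 1) :
    (coGraph E).IsClique (vertexSet E : Set V) ∧ (vertexSet E).card = k := by
  have hrR : (2 : ℝ) ≤ r := by exact_mod_cast hr
  have hrkR : (r : ℝ) ≤ k := by exact_mod_cast hrk
  set N := ∑ v ∈ vertexSet E, w v with hN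
  have hN0 : 0 ≤ N := Finset.sum_nonneg fun v _ => hw v
  have hδN : δ < N := by
    obtain ⟨e, he⟩ := hEne
    obtain ⟨v, hv⟩ := Finset.card_pos.mp (show 0 < e.card by rw [hE he]; omega)
    exact (hcod e he v hv).trans_le (Finset.sum_le_sum_of_subset_of_nonneg
      (Finset.filter_subset _ _) fun u _ _ => hw u)
  have hNpos : 0 < N := by
    rcases hN0.eq_or_lt with h | h
    · rw [← h] at hreg hδN
      rcases hreg with ⟨-, -, h3⟩ | ⟨-, -, h3⟩ <;> nlinarith
    · exact h
  have hrigid : ∀ δ' ≤ δ, ∀ v ∈ vertexSet E,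
      N - ∑ u ∈ commonNbrs (coGraph E) (vertexSet E) {v}, w u < g ∨
        Rigid (coGraph E) (vertexSet E) w k r δ' v := by
    intro δ' hδ' v hv
    rcases lt_or_ge (N - ∑ u ∈ commonNbrs (coGraph E) (vertexSet E) {v}, w u) g with h | h
    · exact Or.inl h
    · obtain ⟨h1, h2⟩ := hlink v hv h
      exact Or.inr ⟨h1, h2, fun c hc0 hc1 hc => hδ'.trans_lt
        (lt_sum_mul_of_card_commonNbrs hr hrk hE hw hcod hv h2 hc0 hc1 hc)⟩
  rcases hreg with ⟨h1, h2, h3⟩ | ⟨h1, h2, h3⟩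
  · have hk : (0 : ℝ) < 3 * k - 2 := by linarith
    have hs : 0 < N / (3 * k - 2) := div_pos hNpos hk
    refine isClique_of_good_or_rigid (δ := (3 * (k : ℝ) - 3 * r + 1) * (N / (3 * k - 2))) hw hs
      hr hrk star (Or.inl ⟨h1, by rw [← hN]; field_simp, rfl, h2⟩) (hrigid _ ?_)
    rw [← mul_div_assoc, div_le_iff₀ hk]
    linarith
  · have hk : (0 : ℝ) < k + 2 := by linarith
    have hs : 0 < N / (k + 2) := div_pos hNpos hk
    refine isClique_of_good_or_rigid (δ := ((k : ℝ) - r + 1) * (N / (k + 2))) hw hs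
      hr hrk star (Or.inr ⟨h1, by rw [← hN]; field_simp, rfl, h2⟩) (hrigid _ ?_)
    rw [← mul_div_assoc, div_le_iff₀ hk]
    linarith

/-- A weighted uniform family with large positive codegrees, in which no clique of `k - 1` vertices
has two common neighbours, lives on a clique of `k` vertices. -/
theorem isClique_of_lt_codegree (hr : 2 ≤ r) : ∀ {k : ℕ} {E : Finset (Finset V)}, r ≤ k →
    E.Nonempty → (E : Set (Finset V)).Sized r → (∀ v, 0 ≤ w v) →
    (∀ e ∈ E, ∀ v ∈ e, δ < ∑ u ∈ extenders E (e.erase v), w u) →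
    (∀ T ⊆ vertexSet E, (coGraph E).IsClique (T : Set V) → T.card = k - 1 →
      ∀ x ∈ commonNbrs (coGraph E) (vertexSet E) T,
      ∀ y ∈ commonNbrs (coGraph E) (vertexSet E) T, x = y) →
    ((4 * (r : ℝ) ≤ 3 * k + 2 ∧
        (3 * (k : ℝ) - 3 * r + 1) * ∑ v ∈ vertexSet E, w v ≤ (3 * k - 2) * δ) ∨
      (3 * (k : ℝ) + 2 ≤ 4 * r ∧
        ((k : ℝ) - r + 1) * ∑ v ∈ vertexSet E, w v ≤ (k + 2) * δ)) →
    (coGraph E).IsClique (vertexSet E : Set V) ∧ (vertexSet E).card = k := by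
  induction r, hr using Nat.le_induction with
  | base =>
    intro k E hrk hEne hE hw hcod star hreg
    have hrkR : (2 : ℝ) ≤ k := by exact_mod_cast hrk
    push_cast at hreg
    -- For `r = 2` the second regime forces `k = 2`, where both constants equal `1/4`. In the first,
    -- `δ ≥ N - g`, so every vertex is good.
    have hreg' : (3 * (k : ℝ) - 3 * 2 + 1) * ∑ v ∈ vertexSet E, w v ≤ (3 * k - 2) * δ := by
      rcases hreg with h | ⟨h, h'⟩
      · exact h.2
      · have hk : (k : ℝ) = 2 := by linarith
        rw [hk] at h' ⊢
        linarith
    refine isClique_of_link le_rfl hrk hEne hE hw hcod star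
      (Or.inl ⟨by push_cast; linarith, rfl, by push_cast; exact hreg'⟩) fun v hv hmiss => ?_
    exfalso
    obtain ⟨e, he, hve⟩ := mem_vertexSet.mp hv
    obtain ⟨u, hu⟩ := Finset.card_pos.mp (show 0 < (e.erase v).card by
      rw [Finset.card_erase_of_mem hve, hE he]; omega)
    rw [Finset.mem_erase] at hu
    have hvS : v ∈ e.erase u := Finset.mem_erase.mpr ⟨hu.1.symm, hve⟩
    have hlt : δ < ∑ u ∈ commonNbrs (coGraph E) (vertexSet E) {v}, w u :=
      (hcod e he u hu.2).trans_le (Finset.sum_le_sum_of_subset_of_nonneg (fun p hp =>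
        mem_commonNbrs_coGraph.mpr
          ⟨fun h => notMem_of_mem_extenders hE he hu.2 hp (h ▸ hvS), _, mem_extenders.mp hp,
            Finset.mem_insert_of_mem hvS, Finset.mem_insert_self _ _⟩) fun u _ _ => hw u)
    have hk : (0 : ℝ) < 3 * k - 2 := by linarith
    have hs : (3 * (k : ℝ) - 2) * ((∑ v ∈ vertexSet E, w v) / (3 * k - 2)) =
      ∑ v ∈ vertexSet E, w v := by field_simp
    have : (3 * (k : ℝ) - 3 * 2 + 1) * ((∑ v ∈ vertexSet E, w v) / (3 * k - 2)) ≤ δ := by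
      rw [← mul_div_assoc, div_le_iff₀ hk]
      linarith
    linarith
  | succ r hr ih =>
    intro k E hrk hEne hE hw hcod star hreg
    have hrR : (2 : ℝ) ≤ r := by exact_mod_cast hr
    have hrkR : (r : ℝ) + 1 ≤ k := by exact_mod_cast hrk
    have hk1 : ((k - 1 : ℕ) : ℝ) = k - 1 := by
      rw [Nat.cast_sub (by omega)]
      norm_num
    have hlink : ∀ v ∈ vertexSet E,
        ((4 * (r : ℝ) ≤ 3 * (k - 1 : ℕ) + 2 ∧
          (3 * ((k - 1 : ℕ) : ℝ) - 3 * r + 1) *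
            ∑ u ∈ commonNbrs (coGraph E) (vertexSet E) {v}, w u ≤ (3 * (k - 1 : ℕ) - 2) * δ) ∨
        (3 * ((k - 1 : ℕ) : ℝ) + 2 ≤ 4 * r ∧
          (((k - 1 : ℕ) : ℝ) - r + 1) *
            ∑ u ∈ commonNbrs (coGraph E) (vertexSet E) {v}, w u ≤ ((k - 1 : ℕ) + 2) * δ)) →
        (coGraph E).IsClique (commonNbrs (coGraph E) (vertexSet E) {v} : Set V) ∧
          (commonNbrs (coGraph E) (vertexSet E) {v}).card = k - 1 := by
      intro v hv hreg
      obtain ⟨e, he, hve⟩ := mem_vertexSet.mp hv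
      have h := ih (k := k - 1) (E := linkFamily E v) (by omega)
        ⟨e.erase v, mem_linkFamily.mpr ⟨Finset.notMem_erase _ _, by
          rwa [Finset.insert_erase hve]⟩⟩ (sized_linkFamily hE) hw
        (lt_sum_extenders_linkFamily hE hw hcod) (star_linkFamily (by omega) star hv)
        (by rwa [vertexSet_linkFamily])
      rw [vertexSet_linkFamily] at h
      exact ⟨h.1.mono coGraph_linkFamily_le, h.2⟩
    -- Lowering `k` and the uniformity by one keeps the second regime only if its inequality is
    -- strict. The boundary, where both constants equal `1/4`, is moved to the first regime, which
    -- always survives.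
    have hreg' : (4 * ((r + 1 : ℕ) : ℝ) ≤ 3 * k + 2 ∧
        (3 * (k : ℝ) - 3 * (r + 1 : ℕ) + 1) * ∑ v ∈ vertexSet E, w v ≤ (3 * k - 2) * δ) ∨
      (3 * (k : ℝ) + 3 ≤ 4 * (r + 1 : ℕ) ∧
        ((k : ℝ) - (r + 1 : ℕ) + 1) * ∑ v ∈ vertexSet E, w v ≤ (k + 2) * δ) := by
      rcases hreg with h | ⟨h, h'⟩
      · exact Or.inl h
      · have hnat : 3 * k + 2 ≤ 4 * (r + 1) := by exact_mod_cast h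
        rcases hnat.eq_or_lt with heq | hlt
        · have heqR : 3 * (k : ℝ) + 2 = 4 * (r + 1 : ℕ) := by exact_mod_cast heq
          refine Or.inl ⟨heqR.symm.le, ?_⟩
          have e1 : (k : ℝ) - (r + 1 : ℕ) + 1 = (k + 2) / 4 := by linarith
          have e2 : 3 * (k : ℝ) - 3 * (r + 1 : ℕ) + 1 = (3 * k - 2) / 4 := by linarith
          rw [e1] at h'
          rw [e2]
          have h'' : (∑ v ∈ vertexSet E, w v) / 4 ≤ δ := by
            refine le_of_mul_le_mul_left (a := (k : ℝ) + 2) ?_ (by positivity)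
            linarith
          have := mul_le_mul_of_nonneg_left h'' (show (0 : ℝ) ≤ 3 * k - 2 by linarith)
          linarith
        · exact Or.inr ⟨by exact_mod_cast hlt, h'⟩
    rcases hreg' with ⟨h1, h2⟩ | ⟨h1, h2⟩
    · have hk : (0 : ℝ) < 3 * k - 2 := by linarith
      refine isClique_of_link (by omega) hrk hEne hE hw hcod star (Or.inl ⟨h1, rfl, h2⟩)
        fun v hv hmiss => hlink v hv (Or.inl ?_)
      push_cast at h1 h2
      obtain ⟨s, hs⟩ : ∃ s, s = (∑ v ∈ vertexSet E, w v) / (3 * k - 2) := ⟨_, rfl⟩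
      have hN : ∑ v ∈ vertexSet E, w v = (3 * (k : ℝ) - 2) * s := by rw [hs]; field_simp
      rw [← hs, hN] at hmiss
      rw [hN, mul_left_comm] at h2
      have h3 := le_of_mul_le_mul_left h2 hk
      rw [hk1]
      refine ⟨by linarith, ?_⟩
      -- The choice of `g` is made for this: `3k - 5 = 3(k - 1) - 2`, so the link meets the same
      -- condition with `k - 1` and `r`.
      have h4 : ∑ u ∈ commonNbrs (coGraph E) (vertexSet E) {v}, w u ≤ (3 * k - 5) * s := by
        linarith
      have h5 := mul_le_mul_of_nonneg_left h4 (show (0 : ℝ) ≤ 3 * (k - 1) - 3 * r + 1 by linarith)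
      have h6 := mul_le_mul_of_nonneg_left h3 (show (0 : ℝ) ≤ 3 * k - 5 by linarith)
      linarith
    · have hk : (0 : ℝ) < k + 2 := by linarith
      refine isClique_of_link (by omega) hrk hEne hE hw hcod star
        (Or.inr ⟨by linarith, rfl, h2⟩) fun v hv hmiss => hlink v hv (Or.inr ?_)
      push_cast at h1 h2
      obtain ⟨s, hs⟩ : ∃ s, s = (∑ v ∈ vertexSet E, w v) / (k + 2) := ⟨_, rfl⟩
      have hN : ∑ v ∈ vertexSet E, w v = ((k : ℝ) + 2) * s := by rw [hs]; field_simp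
      rw [← hs, hN] at hmiss
      rw [hN, mul_left_comm] at h2
      have h3 := le_of_mul_le_mul_left h2 hk
      rw [hk1]
      refine ⟨by linarith, ?_⟩
      have h4 : ∑ u ∈ commonNbrs (coGraph E) (vertexSet E) {v}, w u ≤ (k + 1) * s := by
        linarith
      have h5 := mul_le_mul_of_nonneg_left h4 (show (0 : ℝ) ≤ (k - 1) - r + 1 by linarith)
      have h6 := mul_le_mul_of_nonneg_left h3 (show (0 : ℝ) ≤ k + 1 by linarith)
      linarith

end WeightedFamilies

end CodegreeRigidity

namespace RGraph

open Finset CodegreeRigidity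

theorem threshold_eq_max {k r : ℕ} (hr : 2 ≤ r) (hrk : r ≤ k) :
    threshold k r =
      max (((k : ℝ) - r + 1) / (k + 2)) ((3 * (k : ℝ) - 3 * r + 1) / (3 * k - 2)) := by
  have hrR : (2 : ℝ) ≤ r := by exact_mod_cast hr
  have hrkR : (r : ℝ) ≤ k := by exact_mod_cast hrk
  have h1 : (0 : ℝ) < k + 2 := by linarith
  have h2 : (0 : ℝ) < 3 * k - 2 := by linarith
  rw [threshold]
  split_ifs with h
  · rw [max_eq_left]
    rw [div_le_div_iff₀ h2 h1]
    nlinarith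
  · rw [max_eq_right]
    rw [div_le_div_iff₀ h1 h2]
    nlinarith

/-! ### From two colourings to a weighted family of colour pairs -/

section Sufficiency

variable {V : Type*} {k r : ℕ} {H : RGraph V r}

theorem mem_edges_complete {e : Finset (Fin k)} : e ∈ (complete k r).edges ↔ e.card = r := by
  simp [complete, Finset.mem_powersetCard]

theorem IsHom.injOn {ψ : V → Fin k} (hψ : H.IsHom (complete k r) ψ)
    {e : Finset V} (he : e ∈ H.edges) : Set.InjOn ψ e := by
  rw [← Finset.card_image_iff, mem_edges_complete.mp (hψ e he), H.sized he]

theorem minPosCodegree_le [Fintype V] [DecidableEq V] {e : Finset V} (he : e ∈ H.edges) {v : V}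
    (hv : v ∈ e) : H.minPosCodegree ≤ H.setDegree (e.erase v) :=
  Nat.sInf_le ⟨_, Finset.mem_shadow_iff.mpr ⟨e, he, v, hv, rfl⟩, rfl⟩

theorem eq_of_notMem_image {α : Type*} {T : Finset α} {f : α → Fin k} (hf : Set.InjOn f T)
    (hT : T.card = k - 1) {a b : Fin k} (ha : a ∉ T.image f) (hb : b ∉ T.image f) : a = b := by
  have hcard : (T.image f)ᶜ.card ≤ 1 := by
    rw [Finset.card_compl, Finset.card_image_of_injOn hf, hT, Fintype.card_fin]
    omega
  exact Finset.card_le_one.mp hcard a (Finset.mem_compl.mpr ha) b (Finset.mem_compl.mpr hb)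

/-- The pairs of colours of the edges of `H` in two colourings. -/
def colorPairs (H : RGraph V r) (ψ₁ ψ₂ : V → Fin k) : Finset (Finset (Fin k × Fin k)) :=
  H.edges.image fun e => e.image fun v => (ψ₁ v, ψ₂ v)

variable {ψ₁ ψ₂ : V → Fin k}

theorem IsHom.injOn_pair (h₁ : H.IsHom (complete k r) ψ₁) {e : Finset V} (he : e ∈ H.edges) :
    Set.InjOn (fun v => (ψ₁ v, ψ₂ v)) e := fun _ hx _ hy hxy =>
  h₁.injOn he hx hy (congrArg Prod.fst hxy)

theorem sized_colorPairs (h₁ : H.IsHom (complete k r) ψ₁) :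
    (colorPairs H ψ₁ ψ₂ : Set (Finset (Fin k × Fin k))).Sized r := by
  intro f hf
  rw [mem_coe, colorPairs, Finset.mem_image] at hf
  obtain ⟨e, he, rfl⟩ := hf
  rw [Finset.card_image_of_injOn (h₁.injOn_pair he), H.sized he]

theorem mem_vertexSet_colorPairs (hiso : H.NoIsolated) (v : V) :
    (ψ₁ v, ψ₂ v) ∈ vertexSet (colorPairs H ψ₁ ψ₂) := by
  obtain ⟨e, he, hv⟩ := hiso v
  exact mem_vertexSet.mpr ⟨_, Finset.mem_image_of_mem _ he, Finset.mem_image_of_mem _ hv⟩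

theorem ne_of_coGraph_colorPairs_adj (h₁ : H.IsHom (complete k r) ψ₁)
    (h₂ : H.IsHom (complete k r) ψ₂) {x y : Fin k × Fin k}
    (h : (coGraph (colorPairs H ψ₁ ψ₂)).Adj x y) : x.1 ≠ y.1 ∧ x.2 ≠ y.2 := by
  obtain ⟨hxy, f, hf, hx, hy⟩ := h
  rw [colorPairs, Finset.mem_image] at hf
  obtain ⟨e, he, rfl⟩ := hf
  rw [Finset.mem_image] at hx hy
  obtain ⟨u, hu, rfl⟩ := hx
  obtain ⟨v, hv, rfl⟩ := hy
  have huv : u ≠ v := by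
    rintro rfl
    exact hxy rfl
  exact ⟨fun h => huv (h₁.injOn he hu hv h), fun h => huv (h₂.injOn he hu hv h)⟩

/-- In each coordinate the clique uses `k - 1` distinct colours, leaving one for a common neighbour.
-/
theorem star_colorPairs (h₁ : H.IsHom (complete k r) ψ₁) (h₂ : H.IsHom (complete k r) ψ₂)
    {U T : Finset (Fin k × Fin k)} (hT : (coGraph (colorPairs H ψ₁ ψ₂)).IsClique (T : Set _))
    (hcard : T.card = k - 1) {x y : Fin k × Fin k}
    (hx : x ∈ commonNbrs (coGraph (colorPairs H ψ₁ ψ₂)) U T)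
    (hy : y ∈ commonNbrs (coGraph (colorPairs H ψ₁ ψ₂)) U T) : x = y := by
  have key := fun {x y} => ne_of_coGraph_colorPairs_adj (x := x) (y := y) h₁ h₂
  have i1 : Set.InjOn Prod.fst (T : Set (Fin k × Fin k)) := fun a ha b hb hab => by
    by_contra hne
    exact (key (hT ha hb hne)).1 hab
  have i2 : Set.InjOn Prod.snd (T : Set (Fin k × Fin k)) := fun a ha b hb hab => by
    by_contra hne
    exact (key (hT ha hb hne)).2 hab
  have n1 : ∀ z ∈ commonNbrs (coGraph (colorPairs H ψ₁ ψ₂)) U T, z.1 ∉ T.image Prod.fst := by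
    intro z hz hmem
    obtain ⟨t, ht, htz⟩ := Finset.mem_image.mp hmem
    exact (key ((mem_commonNbrs.mp hz).2 t ht)).1 htz
  have n2 : ∀ z ∈ commonNbrs (coGraph (colorPairs H ψ₁ ψ₂)) U T, z.2 ∉ T.image Prod.snd := by
    intro z hz hmem
    obtain ⟨t, ht, htz⟩ := Finset.mem_image.mp hmem
    exact (key ((mem_commonNbrs.mp hz).2 t ht)).2 htz
  exact Prod.ext (eq_of_notMem_image i1 hcard (n1 x hx) (n1 y hy))
    (eq_of_notMem_image i2 hcard (n2 x hx) (n2 y hy))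

/-- Both projections are injective on a clique; with `k` pairs they are bijective, so the pairs form
the graph of a permutation. -/
theorem homEquiv_of_isClique (h₁ : H.IsHom (complete k r) ψ₁) (h₂ : H.IsHom (complete k r) ψ₂)
    (hiso : H.NoIsolated)
    (hcl : (coGraph (colorPairs H ψ₁ ψ₂)).IsClique (vertexSet (colorPairs H ψ₁ ψ₂) : Set _))
    (hcard : (vertexSet (colorPairs H ψ₁ ψ₂)).card = k) : (complete k r).HomEquiv ψ₁ ψ₂ := by
  set U := vertexSet (colorPairs H ψ₁ ψ₂)
  have i1 : ∀ a ∈ U, ∀ b ∈ U, a.1 = b.1 → a = b := fun a ha b hb hab => by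
    by_contra hne
    exact (ne_of_coGraph_colorPairs_adj h₁ h₂ (hcl ha hb hne)).1 hab
  have i2 : ∀ a ∈ U, ∀ b ∈ U, a.2 = b.2 → a = b := fun a ha b hb hab => by
    by_contra hne
    exact (ne_of_coGraph_colorPairs_adj h₁ h₂ (hcl ha hb hne)).2 hab
  have himage : U.image Prod.fst = Finset.univ := by
    rw [← Finset.card_eq_iff_eq_univ, Finset.card_image_of_injOn fun a ha b hb h => i1 a ha b hb h,
      hcard, Fintype.card_fin]
  have hex : ∀ i : Fin k, ∃ c ∈ U, c.1 = i := fun i =>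
    Finset.mem_image.mp (himage ▸ Finset.mem_univ i)
  choose c hcU hc using hex
  have hinj : Function.Injective fun i => (c i).2 := fun i j hij => by
    rw [← hc i, ← hc j, i2 _ (hcU i) _ (hcU j) hij]
  refine ⟨fun i => (c i).2, ⟨fun e he => ?_, Finite.surjective_of_injective hinj⟩, ?_⟩
  · rw [mem_edges_complete] at he ⊢
    rw [Finset.card_image_of_injective _ hinj, he]
  · funext v
    have := i1 _ (hcU (ψ₁ v)) _ (mem_vertexSet_colorPairs hiso v) (hc _)
    simp [this]

theorem lt_sum_extenders_colorPairs [Fintype V] [DecidableEq V] {δ : ℝ}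
    (hδ : δ < (H.minPosCodegree : ℝ)) (h₁ : H.IsHom (complete k r) ψ₁) :
    ∀ f ∈ colorPairs H ψ₁ ψ₂, ∀ x ∈ f, δ < ∑ c ∈ extenders (colorPairs H ψ₁ ψ₂) (f.erase x),
      ((Finset.univ.filter fun v => (ψ₁ v, ψ₂ v) = c).card : ℝ) := by
  intro f hf x hx
  rw [colorPairs, Finset.mem_image] at hf
  obtain ⟨e, he, rfl⟩ := hf
  obtain ⟨v, hv, rfl⟩ := Finset.mem_image.mp hx
  refine hδ.trans_le ?_
  rw [← Nat.cast_sum, Nat.cast_le]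
  refine (minPosCodegree_le he hv).trans ?_
  have hmaps : ∀ u ∈ Finset.univ.filter (fun u => insert u (e.erase v) ∈ H.edges),
      (ψ₁ u, ψ₂ u) ∈ extenders (colorPairs H ψ₁ ψ₂)
        ((e.image fun v => (ψ₁ v, ψ₂ v)).erase (ψ₁ v, ψ₂ v)) := by
    intro u hu
    rw [Finset.mem_filter] at hu
    have h := Finset.mem_image_of_mem (fun e => e.image fun v => (ψ₁ v, ψ₂ v)) hu.2
    rw [Finset.image_insert, ← Finset.sdiff_singleton_eq_erase, Finset.image_sdiff_of_injOn
      (h₁.injOn_pair he) (Finset.singleton_subset_iff.mpr hv), Finset.image_singleton,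
      Finset.sdiff_singleton_eq_erase] at h
    exact mem_extenders.mpr h
  rw [setDegree, Finset.card_eq_sum_card_fiberwise hmaps]
  exact Finset.sum_le_sum fun c _ =>
    Finset.card_le_card (Finset.filter_subset_filter _ (Finset.filter_subset _ _))

/-- Large positive codegree forces unique colourability. -/
theorem uniquelyColorable_of_lt [Fintype V] [DecidableEq V] (hr : 2 ≤ r) (hrk : r ≤ k)
    (hcard : k ≤ Fintype.card V) (hcol : H.Colorable k) (hiso : H.NoIsolated)
    (hdeg : threshold k r * (Fintype.card V : ℝ) < (H.minPosCodegree : ℝ)) :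
    H.UniquelyColorable k := by
  refine ⟨hcol, fun ψ₁ ψ₂ h₁ h₂ => ?_⟩
  have hrR : (2 : ℝ) ≤ r := by exact_mod_cast hr
  have hrkR : (r : ℝ) ≤ k := by exact_mod_cast hrk
  have hsum : ∑ c ∈ vertexSet (colorPairs H ψ₁ ψ₂),
      ((Finset.univ.filter fun v => (ψ₁ v, ψ₂ v) = c).card : ℝ) = Fintype.card V := by
    rw [← Nat.cast_sum, ← Finset.card_eq_sum_card_fiberwise fun v _ =>
      mem_coe.mpr (mem_vertexSet_colorPairs hiso v), Finset.card_univ]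
  have hne : (colorPairs H ψ₁ ψ₂).Nonempty := by
    obtain ⟨v⟩ := Fintype.card_pos_iff.mp (show 0 < Fintype.card V by omega)
    obtain ⟨e, he, -⟩ := hiso v
    exact ⟨_, Finset.mem_image_of_mem _ he⟩
  obtain ⟨hcl, hk⟩ := isClique_of_lt_codegree (E := colorPairs H ψ₁ ψ₂)
    (w := fun c => ((Finset.univ.filter fun v => (ψ₁ v, ψ₂ v) = c).card : ℝ))
    hr hrk hne (sized_colorPairs h₁) (fun c => Nat.cast_nonneg _)
    (lt_sum_extenders_colorPairs hdeg h₁)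
    (fun T _ hT hTc x hx y hy => star_colorPairs h₁ h₂ hT hTc hx hy) (by
      rw [hsum, threshold]
      split_ifs with h
      · refine Or.inr ⟨by linarith, le_of_eq ?_⟩
        field_simp
      · refine Or.inl ⟨by linarith, le_of_eq ?_⟩
        have : (3 * (k : ℝ) - 2) ≠ 0 := by linarith
        field_simp)
  exact homEquiv_of_isClique h₁ h₂ hiso hcl hk

end Sufficiency

/-! ### The parts and edges of the two-halves construction -/

section Parts

variable {k r a m : ℕ}

/-- The parts that make up one half of the construction. -/
def halfParts (k : ℕ) (j : Fin 2) : Finset (Fin (k - 2) ⊕ (Fin 2 × Fin 2)) :=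
  Finset.univ.disjSum (Finset.univ ×ˢ {j})

/-- The number of vertices of a part. -/
def partSize (k a m : ℕ) : Fin (k - 2) ⊕ (Fin 2 × Fin 2) → ℕ :=
  Sum.elim (fun _ => a) fun _ => m

theorem mem_halfParts_inr {s j j' : Fin 2} :
    (Sum.inr (s, j') : Fin (k - 2) ⊕ (Fin 2 × Fin 2)) ∈ halfParts k j ↔ j' = j := by
  simp [halfParts, eq_comm]

theorem mem_halfParts_inl {i : Fin (k - 2)} {j : Fin 2} :
    (Sum.inl i : Fin (k - 2) ⊕ (Fin 2 × Fin 2)) ∈ halfParts k j := by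
  simp [halfParts]

theorem mem_halfSet {v : BlowupVertex k a m} {j : Fin 2} :
    v ∈ halfSet k a m j ↔ partOf v ∈ halfParts k j := by
  rw [halfSet, Finset.mem_filter, and_iff_right (Finset.mem_univ v)]
  rcases h : partOf v with i | ⟨s, j'⟩
  · simp [mem_halfParts_inl]
  · rw [mem_halfParts_inr]
    constructor
    · exact fun h => h s j' rfl
    · rintro rfl s' j'' h
      simp only [Sum.inr.injEq, Prod.mk.injEq] at h
      exact h.2.symm

theorem card_halfParts (hk : 2 ≤ k) (j : Fin 2) : (halfParts k j).card = k := by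
  simp only [halfParts, Finset.card_disjSum, Finset.card_univ, Fintype.card_fin,
    Finset.card_product, Finset.card_singleton]
  omega

theorem sum_partSize (P : Finset (Fin (k - 2) ⊕ (Fin 2 × Fin 2))) :
    ∑ p ∈ P, partSize k a m p = P.toLeft.card * a + P.toRight.card * m := by
  conv_lhs => rw [← Finset.toLeft_disjSum_toRight (u := P), Finset.sum_disjSum]
  simp [partSize]

theorem card_filter_partOf_mem (P : Finset (Fin (k - 2) ⊕ (Fin 2 × Fin 2))) :
    (Finset.univ.filter fun v : BlowupVertex k a m => partOf v ∈ P).card =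
      ∑ p ∈ P, partSize k a m p := by
  rw [Finset.card_eq_sum_card_fiberwise (f := partOf) (t := P) fun v hv => by simpa using hv]
  refine Finset.sum_congr rfl fun p hp => ?_
  rw [Finset.filter_filter]
  rcases p with i | ⟨s, j⟩
  · have : (Finset.univ.filter fun v : BlowupVertex k a m => partOf v ∈ P ∧ partOf v = Sum.inl i) =
        ({i} ×ˢ Finset.univ).disjSum ∅ := by
      ext v
      rw [Finset.mem_filter, and_iff_right (Finset.mem_univ v)]
      rcases v with ⟨i', x⟩ | ⟨s', j', x⟩
      · simp only [partOf, Sum.inl.injEq, Finset.inl_mem_disjSum, Finset.mem_product,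
          Finset.mem_singleton, Finset.mem_univ, and_true, and_iff_right_iff_imp]
        rintro rfl
        exact hp
      · simp [partOf]
    simp [this, partSize]
  · have : (Finset.univ.filter fun v : BlowupVertex k a m =>
        partOf v ∈ P ∧ partOf v = Sum.inr (s, j)) =
        (∅ : Finset (Fin (k - 2) × Fin a)).disjSum ({s} ×ˢ {j} ×ˢ Finset.univ) := by
      ext v
      rw [Finset.mem_filter, and_iff_right (Finset.mem_univ v)]
      rcases v with ⟨i', x⟩ | ⟨s', j', x⟩
      · simp [partOf]
      · simp only [partOf, Sum.inr.injEq, Prod.mk.injEq, Finset.inr_mem_disjSum,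
          Finset.mem_product, Finset.mem_singleton, Finset.mem_univ, and_true,
          and_iff_right_iff_imp]
        rintro ⟨rfl, rfl⟩
        exact hp
    simp [this, partSize]

theorem exists_partOf_eq (ha : 1 ≤ a) (hm : 1 ≤ m) (p : Fin (k - 2) ⊕ (Fin 2 × Fin 2)) :
    ∃ v : BlowupVertex k a m, partOf v = p := by
  rcases p with i | ⟨s, j⟩
  · exact ⟨Sum.inl (i, ⟨0, ha⟩), rfl⟩
  · exact ⟨Sum.inr (s, j, ⟨0, hm⟩), rfl⟩

theorem card_blowupVertex (k a m : ℕ) :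
    Fintype.card (BlowupVertex k a m) = (k - 2) * a + 4 * m := by
  simp only [Fintype.card_sum, Fintype.card_prod, Fintype.card_fin]
  ring

theorem mem_edges_twoHalves {e : Finset (BlowupVertex k a m)} :
    e ∈ (twoHalves k r a m).edges ↔
      e.card = r ∧ ∃ j, e ⊆ halfSet k a m j ∧ Set.InjOn partOf (e : Set (BlowupVertex k a m)) := by
  have : (∀ p, (e.filter fun v => partOf v = p).card ≤ 1) ↔
      Set.InjOn partOf (e : Set (BlowupVertex k a m)) := by
    simp only [Finset.card_le_one, Finset.mem_filter]
    constructor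
    · exact fun h x hx y hy hxy => h (partOf y) x ⟨hx, hxy⟩ y ⟨hy, rfl⟩
    · exact fun h p x hx y hy => h hx.1 hy.1 (hx.2.trans hy.2.symm)
  simp only [twoHalves, Finset.mem_filter, Finset.mem_powersetCard, Finset.subset_univ, true_and,
    this]

theorem exists_edge_superset (hk : 2 ≤ k) (hrk : r ≤ k) (ha : 1 ≤ a) (hm : 1 ≤ m) {j : Fin 2} :
    ∀ (n : ℕ) (T : Finset (BlowupVertex k a m)), T ⊆ halfSet k a m j →
      Set.InjOn partOf (T : Set (BlowupVertex k a m)) → T.card + n = r →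
      ∃ e ∈ (twoHalves k r a m).edges, T ⊆ e := by
  intro n
  induction n with
  | zero => exact fun T h1 h2 h3 => ⟨T, mem_edges_twoHalves.mpr ⟨h3, j, h1, h2⟩, subset_rfl⟩
  | succ n ih =>
    intro T h1 h2 h3
    obtain ⟨p, hp, hpT⟩ : ∃ p ∈ halfParts k j, p ∉ T.image partOf :=
      Finset.exists_mem_notMem_of_card_lt_card (by
        rw [card_halfParts hk, Finset.card_image_of_injOn h2]
        omega)
    obtain ⟨v, rfl⟩ := exists_partOf_eq ha hm p
    have hvT : v ∉ T := fun h => hpT (Finset.mem_image_of_mem _ h)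
    obtain ⟨e, he, hTe⟩ := ih (insert v T) (Finset.insert_subset (mem_halfSet.mpr hp) h1) (by
      rw [Finset.coe_insert, Set.injOn_insert (by exact_mod_cast hvT)]
      exact ⟨h2, fun h => hpT (by simpa using h)⟩) (by
      rw [Finset.card_insert_of_notMem hvT]
      omega)
    exact ⟨e, he, (Finset.subset_insert _ _).trans hTe⟩

theorem noIsolated_twoHalves (hr : 2 ≤ r) (hrk : r ≤ k) (ha : 1 ≤ a) (hm : 1 ≤ m) :
    (twoHalves k r a m).NoIsolated := by
  intro v
  obtain ⟨j, hj⟩ : ∃ j, v ∈ halfSet k a m j := by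
    rcases v with ⟨i, x⟩ | ⟨s, j, x⟩
    · exact ⟨0, mem_halfSet.mpr mem_halfParts_inl⟩
    · exact ⟨j, mem_halfSet.mpr (mem_halfParts_inr.mpr rfl)⟩
  obtain ⟨e, he, hve⟩ := exists_edge_superset (r := r) (by omega) hrk ha hm (r - 1) {v}
    (Finset.singleton_subset_iff.mpr hj) (by simp) (by simp; omega)
  exact ⟨e, he, Finset.singleton_subset_iff.mp hve⟩

end Parts

/-! ### Codegrees of the construction -/

section Codegree

variable {k r a m : ℕ} {S : Finset (BlowupVertex k a m)}

theorem insert_mem_edges_twoHalves {j : Fin 2} {v : BlowupVertex k a m} (hr : 1 ≤ r)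
    (hcard : S.card = r - 1) (hS : S ⊆ halfSet k a m j)
    (hinj : Set.InjOn partOf (S : Set (BlowupVertex k a m))) (hv : v ∈ halfSet k a m j)
    (hvS : partOf v ∉ S.image partOf) : insert v S ∈ (twoHalves k r a m).edges := by
  have hvS' : v ∉ S := fun h => hvS (Finset.mem_image_of_mem _ h)
  refine mem_edges_twoHalves.mpr ⟨?_, j, Finset.insert_subset hv hS, ?_⟩
  · rw [Finset.card_insert_of_notMem hvS']
    omega
  · rw [Finset.coe_insert, Set.injOn_insert (by exact_mod_cast hvS')]
    exact ⟨hinj, fun h => hvS (by simpa using h)⟩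

theorem card_toLeft_add_card_toRight_image (hcard : S.card = r - 1)
    (hinj : Set.InjOn partOf (S : Set (BlowupVertex k a m))) :
    (S.image partOf).toLeft.card + (S.image partOf).toRight.card = r - 1 := by
  rw [Finset.card_toLeft_add_card_toRight, Finset.card_image_of_injOn hinj, hcard]

/-- The degree of an `(r - 1)`-set that contains a vertex of one of the special parts. -/
theorem setDegree_add_of_special {s j : Fin 2} (hr : 2 ≤ r) (hcard : S.card = r - 1)
    (hS : S ⊆ halfSet k a m j) (hinj : Set.InjOn partOf (S : Set (BlowupVertex k a m)))
    (hs : Sum.inr (s, j) ∈ S.image partOf) :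
    (twoHalves k r a m).setDegree S + ((S.image partOf).toLeft.card * a +
      (S.image partOf).toRight.card * m) = (k - 2) * a + 2 * m := by
  have hsub : S.image partOf ⊆ halfParts k j := by
    rw [Finset.image_subset_iff]
    exact fun v hv => mem_halfSet.mp (hS hv)
  have hdeg : (twoHalves k r a m).setDegree S =
      ∑ p ∈ halfParts k j \ S.image partOf, partSize k a m p := by
    rw [setDegree, ← card_filter_partOf_mem]
    congr 1
    ext v
    simp only [Finset.mem_filter, Finset.mem_univ, true_and, Finset.mem_sdiff]
    constructor
    · intro h
      obtain ⟨h1, j', h2, h3⟩ := mem_edges_twoHalves.mp h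
      have hvS : v ∉ S := fun hv => by
        rw [Finset.insert_eq_of_mem hv] at h1
        omega
      have hj : j = j' := by
        obtain ⟨u, hu, hus⟩ := Finset.mem_image.mp hs
        have := mem_halfSet.mp (h2 (Finset.mem_insert_of_mem hu))
        rw [hus] at this
        exact mem_halfParts_inr.mp this
      refine ⟨hj ▸ mem_halfSet.mp (h2 (Finset.mem_insert_self _ _)), fun hmem => ?_⟩
      obtain ⟨u, hu, huv⟩ := Finset.mem_image.mp hmem
      have := h3 (by simp [hu]) (by simp) huv
      exact hvS (this ▸ hu)
    · exact fun h => insert_mem_edges_twoHalves (by omega) hcard hS hinj (mem_halfSet.mpr h.1) h.2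
  rw [hdeg, ← sum_partSize, Finset.sum_sdiff hsub, sum_partSize, halfParts, Finset.toLeft_disjSum,
    Finset.toRight_disjSum]
  simp

/-- A set without special vertices lies in both halves, so all four special parts extend it. -/
theorem le_setDegree_of_ordinary (hr : 2 ≤ r) (hcard : S.card = r - 1)
    (hinj : Set.InjOn partOf (S : Set (BlowupVertex k a m)))
    (hs : (S.image partOf).toRight = ∅) :
    (k - 2) * a + 4 * m ≤
      (twoHalves k r a m).setDegree S + (S.image partOf).toLeft.card * a := by
  have hle : ∑ p ∈ (S.image partOf)ᶜ, partSize k a m p ≤ (twoHalves k r a m).setDegree S := by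
    rw [setDegree, ← card_filter_partOf_mem]
    refine Finset.card_le_card fun v hv => ?_
    simp only [Finset.mem_filter, Finset.mem_univ, true_and, Finset.mem_compl] at hv ⊢
    have hall : ∀ j', S ⊆ halfSet k a m j' := fun j' u hu => by
      rw [mem_halfSet]
      rcases h : partOf u with i | q
      · exact mem_halfParts_inl
      · have : q ∈ (S.image partOf).toRight :=
          Finset.mem_toRight.mpr (h ▸ Finset.mem_image_of_mem _ hu)
        simp [hs] at this
    obtain ⟨j', hj'⟩ : ∃ j', v ∈ halfSet k a m j' := by
      rcases v with ⟨i, x⟩ | ⟨s, j, x⟩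
      · exact ⟨0, mem_halfSet.mpr mem_halfParts_inl⟩
      · exact ⟨j, mem_halfSet.mpr (mem_halfParts_inr.mpr rfl)⟩
    exact insert_mem_edges_twoHalves (by omega) hcard (hall j') hinj hj' hv
  have htot : ∑ p, partSize k a m p = (k - 2) * a + 4 * m := by
    simp [partSize, Fintype.sum_sum_type]
  have hP := sum_partSize (a := a) (m := m) (S.image partOf)
  rw [hs, Finset.card_empty, zero_mul, add_zero] at hP
  have := Finset.sum_compl_add_sum (S.image partOf) (partSize k a m)
  omega

/-- With `0`, `1`, `2` special vertices the degree is at least `(k - r)a - a + 4m`, `(k - r)a + m`,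
`(k - r)a + a`; the first case needs `a ≤ 3m` and the last `m ≤ a`. -/
theorem le_setDegree_of_mem_shadow (hr : 2 ≤ r) (hrk : r ≤ k) (hma : m ≤ a) (ham : a ≤ 3 * m)
    (hS : S ∈ (twoHalves k r a m).edges.shadow) :
    (k - r) * a + m ≤ (twoHalves k r a m).setDegree S := by
  obtain ⟨v, hvS, hv⟩ := Finset.mem_shadow_iff_insert_mem.mp hS
  obtain ⟨h1, j, h2, h3⟩ := mem_edges_twoHalves.mp hv
  have hcard : S.card = r - 1 := by
    rw [Finset.card_insert_of_notMem hvS] at h1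
    omega
  have hSj : S ⊆ halfSet k a m j := (Finset.subset_insert _ _).trans h2
  have hinj : Set.InjOn partOf (S : Set (BlowupVertex k a m)) :=
    h3.mono (by exact_mod_cast Finset.subset_insert _ _)
  have hsum := card_toLeft_add_card_toRight_image hcard hinj
  rcases (S.image partOf).toRight.eq_empty_or_nonempty with hs | ⟨⟨s, j'⟩, hs⟩
  · have h := le_setDegree_of_ordinary hr hcard hinj hs
    rw [hs, Finset.card_empty, add_zero] at hsum
    have hle : (S.image partOf).toLeft.card ≤ k - 2 :=
      (Finset.card_le_univ _).trans_eq (Fintype.card_fin _)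
    rw [hsum] at h hle
    -- The truncated `k - r - 1` is genuine: `r - 1` distinct ordinary parts force `r < k`.
    have e1 : (k - 2) * a = (r - 1) * a + (k - r - 1) * a := by
      rw [← add_mul]
      congr 1
      omega
    have e2 : (k - r) * a = (k - r - 1) * a + a := by
      rw [← add_one_mul]
      congr 1
      omega
    omega
  · have hs' := Finset.mem_toRight.mp hs
    have hj : j' = j := by
      obtain ⟨u, hu, hus⟩ := Finset.mem_image.mp hs'
      have := mem_halfSet.mp (hSj hu)
      rw [hus] at this
      exact mem_halfParts_inr.mp this
    subst hj
    have h := setDegree_add_of_special hr hcard hSj hinj hs'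
    have hle : (S.image partOf).toRight.card ≤ 2 := by
      have hsub : (S.image partOf).toRight ⊆ Finset.univ ×ˢ {j'} := by
        rintro ⟨s₁, j₁⟩ hq
        obtain ⟨u, hu, hus⟩ := Finset.mem_image.mp (Finset.mem_toRight.mp hq)
        have := mem_halfSet.mp (hSj hu)
        rw [hus] at this
        simpa [eq_comm] using mem_halfParts_inr.mp this
      simpa using Finset.card_le_card hsub
    have hpos : 0 < (S.image partOf).toRight.card := Finset.card_pos.mpr ⟨_, hs⟩
    obtain hc | hc : (S.image partOf).toRight.card = 1 ∨ (S.image partOf).toRight.card = 2 := by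
      omega
    · rw [hc] at h hsum
      have e : (k - 2) * a = (S.image partOf).toLeft.card * a + (k - r) * a := by
        rw [← add_mul]
        congr 1
        omega
      omega
    · rw [hc] at h hsum
      have e : (k - 2) * a = (S.image partOf).toLeft.card * a + (k - r) * a + a := by
        rw [← add_mul, ← add_one_mul]
        congr 1
        omega
      omega

theorem minPosCodegree_twoHalves (hr : 2 ≤ r) (hrk : r ≤ k) (hm : 1 ≤ m) (hma : m ≤ a)
    (ham : a ≤ 3 * m) : (twoHalves k r a m).minPosCodegree = (k - r) * a + m := by
  have ha : 1 ≤ a := hm.trans hma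
  obtain ⟨A, -, hA⟩ := Finset.exists_subset_card_eq (s := (Finset.univ : Finset (Fin (k - 2))))
    (n := r - 2) (by simp; omega)
  -- The minimum is attained with exactly one special vertex and `r - 2` ordinary ones.
  set S : Finset (BlowupVertex k a m) :=
    (A ×ˢ {(⟨0, ha⟩ : Fin a)}).disjSum {(0, 0, (⟨0, hm⟩ : Fin m))} with hSdef
  have himage : S.image partOf = A.disjSum {((0 : Fin 2), (0 : Fin 2))} := by
    ext p
    rcases p with i | ⟨s, j⟩ <;> simp [hSdef, partOf, eq_comm]
  have hcard : S.card = r - 1 := by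
    simp only [hSdef, Finset.card_disjSum, Finset.card_product, Finset.card_singleton, hA]
    omega
  have hinj : Set.InjOn partOf (S : Set (BlowupVertex k a m)) := by
    rw [← Finset.card_image_iff, himage, hcard, Finset.card_disjSum, hA, Finset.card_singleton]
    omega
  have hS : S ⊆ halfSet k a m 0 := fun v hv => by
    have := Finset.mem_image_of_mem partOf hv
    rw [himage] at this
    rw [mem_halfSet]
    rcases h : partOf v with i | ⟨s, j⟩
    · exact mem_halfParts_inl
    · rw [h] at this
      simp only [Finset.inr_mem_disjSum, Finset.mem_singleton, Prod.mk.injEq] at this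
      exact mem_halfParts_inr.mpr this.2
  have hdeg := setDegree_add_of_special (s := 0) hr hcard hS hinj (by simp [himage])
  rw [himage, Finset.toLeft_disjSum, Finset.toRight_disjSum, Finset.card_singleton, hA] at hdeg
  have hshadow : S ∈ (twoHalves k r a m).edges.shadow := by
    obtain ⟨e, he, hSe⟩ := exists_edge_superset (by omega) hrk ha hm 1 S hS hinj
      (show S.card + 1 = r by omega)
    refine Finset.mem_shadow_iff_exists_mem_card_add_one.mpr ⟨e, he, hSe, ?_⟩
    rw [(mem_edges_twoHalves.mp he).1]
    omega
  refine le_antisymm (Nat.sInf_le ⟨S, hshadow, ?_⟩) (le_csInf ⟨_, S, hshadow, rfl⟩ ?_)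
  · have e : (k - 2) * a = (r - 2) * a + (k - r) * a := by
      rw [← add_mul]
      congr 1
      omega
    omega
  · rintro d ⟨S', hS', rfl⟩
    exact le_setDegree_of_mem_shadow hr hrk hma ham hS'

end Codegree

/-! ### Inequivalent colourings and optimality -/

section Colorings

variable {k r a m : ℕ}

/-- The colouring of the parts that gives the ordinary parts their own colours and uses the
remaining two colours on the special parts of the half `j` according to `π j`. -/
def partColor (hk : 2 ≤ k) (π : Fin 2 → Fin 2 → Fin 2) :
    Fin (k - 2) ⊕ (Fin 2 × Fin 2) → Fin k :=
  Sum.elim (fun i => ⟨i, by omega⟩) fun q => ⟨k - 2 + π q.2 q.1, by omega⟩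

theorem injOn_partColor (hk : 2 ≤ k) {π : Fin 2 → Fin 2 → Fin 2}
    (hπ : ∀ j, Function.Injective (π j)) (j : Fin 2) :
    Set.InjOn (partColor hk π) (halfParts k j : Set (Fin (k - 2) ⊕ (Fin 2 × Fin 2))) := by
  rintro (i | ⟨s, j₁⟩) h₁ (i' | ⟨s', j₂⟩) h₂ h
  · simpa [partColor, Fin.ext_iff] using h
  · simp only [partColor, Sum.elim_inl, Sum.elim_inr, Fin.mk.injEq] at h
    omega
  · simp only [partColor, Sum.elim_inl, Sum.elim_inr, Fin.mk.injEq] at h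
    omega
  · rw [mem_coe, mem_halfParts_inr] at h₁ h₂
    subst h₁ h₂
    simp only [partColor, Sum.elim_inr, Fin.mk.injEq, Nat.add_left_cancel_iff] at h
    rw [hπ _ (Fin.ext h)]

theorem isHom_partColor (hk : 2 ≤ k) {π : Fin 2 → Fin 2 → Fin 2}
    (hπ : ∀ j, Function.Injective (π j)) :
    (twoHalves k r a m).IsHom (complete k r) (partColor hk π ∘ partOf) := by
  intro e he
  obtain ⟨h1, j, h2, h3⟩ := mem_edges_twoHalves.mp he
  rw [mem_edges_complete, Finset.card_image_of_injOn, h1]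
  exact (injOn_partColor hk hπ j).comp h3 fun v hv => mem_halfSet.mp (h2 hv)

theorem colorable_twoHalves (hk : 2 ≤ k) : (twoHalves k r a m).Colorable k :=
  ⟨_, isHom_partColor hk (π := fun _ s => s) fun _ => Function.injective_id⟩

/-- The first colouring agrees on the parts `(0, 0)` and `(0, 1)`, while the second, with the last
two colours swapped on half `1`, separates them; no map `η` can do that. -/
theorem not_uniquelyColorable_twoHalves (hk : 2 ≤ k) (hm : 1 ≤ m) :
    ¬ (twoHalves k r a m).UniquelyColorable k := by
  rintro ⟨-, h⟩
  obtain ⟨η, -, hη⟩ := h _ _ (isHom_partColor hk (π := fun _ s => s) fun _ => Function.injective_id)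
    (isHom_partColor hk (π := fun j s => s + j) fun j => add_left_injective j)
  have h0 := congrFun hη (Sum.inr (0, 0, ⟨0, hm⟩))
  have h1 := congrFun hη (Sum.inr (0, 1, ⟨0, hm⟩))
  simp only [Function.comp_apply, partOf, partColor, Sum.elim_inr] at h0 h1
  rw [h0] at h1
  simp at h1

end Colorings

theorem minPosCodegree_construction_one {k r m : ℕ} (hr : 2 ≤ r) (hrk : r ≤ k) (hm : 1 ≤ m) :
    ((construction k r 1 m).minPosCodegree : ℝ) =
      ((k : ℝ) - r + 1) / (k + 2) *
        (Fintype.card (BlowupVertex k ⌊(1 : ℝ) * m⌋₊ m) : ℝ) := by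
  have ha : ⌊(1 : ℝ) * m⌋₊ = m := by simp
  rw [construction, minPosCodegree_twoHalves hr hrk hm ha.ge (by omega), card_blowupVertex, ha]
  push_cast [Nat.cast_sub hrk, Nat.cast_sub (hr.trans hrk)]
  field_simp
  ring

theorem floor_three_mul (m : ℕ) : ⌊(3 : ℝ) * m⌋₊ = 3 * m := by
  exact_mod_cast Nat.floor_natCast (R := ℝ) (3 * m)

theorem minPosCodegree_construction_three {k r m : ℕ} (hr : 2 ≤ r) (hrk : r ≤ k) (hm : 1 ≤ m) :
    ((construction k r 3 m).minPosCodegree : ℝ) =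
      (3 * (k : ℝ) - 3 * r + 1) / (3 * k - 2) *
        (Fintype.card (BlowupVertex k ⌊(3 : ℝ) * m⌋₊ m) : ℝ) := by
  have ha := floor_three_mul m
  have hk : (2 : ℝ) ≤ k := by exact_mod_cast hr.trans hrk
  have hk' : 3 * (k : ℝ) - 2 ≠ 0 := by linarith
  rw [construction, minPosCodegree_twoHalves hr hrk hm (by omega) ha.le, card_blowupVertex, ha]
  push_cast [Nat.cast_sub hrk, Nat.cast_sub (hr.trans hrk)]
  rw [div_mul_eq_mul_div, eq_div_iff hk']
  ring

theorem le_card_blowupVertex {k a m : ℕ} (ha : 1 ≤ a) (hm : 1 ≤ m) :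
    k ≤ Fintype.card (BlowupVertex k a m) := by
  rw [card_blowupVertex]
  have := Nat.le_mul_of_pos_right (k - 2) ha
  omega

theorem le_of_mem_forcingConstants {k r a m : ℕ} (hr : 2 ≤ r) (hrk : r ≤ k) (ha : 1 ≤ a)
    (hm : 1 ≤ m) {x c : ℝ}
    (hx : ((twoHalves k r a m).minPosCodegree : ℝ) =
      x * (Fintype.card (BlowupVertex k a m) : ℝ))
    (hc : c ∈ forcingConstants k r) : x ≤ c := by
  by_contra hcon
  refine not_uniquelyColorable_twoHalves (r := r) (a := a) (hr.trans hrk) hm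
    (hc _ _ (le_card_blowupVertex ha hm) (colorable_twoHalves (hr.trans hrk))
      (noIsolated_twoHalves hr hrk ha hm) ?_)
  rw [hx]
  refine mul_lt_mul_of_pos_right (not_le.mp hcon) ?_
  have := le_card_blowupVertex (k := k) ha hm
  exact_mod_cast (show 0 < k by omega).trans_le this

theorem isLeast_forcingConstants {k r : ℕ} (hr : 2 ≤ r) (hrk : r ≤ k) :
    IsLeast (forcingConstants k r) (threshold k r) := by
  refine ⟨fun V _ _ H => uniquelyColorable_of_lt hr hrk, fun c hc => ?_⟩
  rw [threshold_eq_max hr hrk]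
  exact max_le
    (le_of_mem_forcingConstants hr hrk (by simp) le_rfl
      (minPosCodegree_construction_one hr hrk le_rfl) hc)
    (le_of_mem_forcingConstants hr hrk (by rw [floor_three_mul]; norm_num) le_rfl
      (minPosCodegree_construction_three hr hrk le_rfl) hc)

end RGraph

theorem theorem1p2 (k r : ℕ) (hr : 2 ≤ r) (hkr : r ≤ k) :
    -- the constant is sufficient
    (∀ (V : Type*) [Fintype V] [DecidableEq V] (H : RGraph V r),
      k ≤ Fintype.card V → H.Colorable k → H.NoIsolated →
      RGraph.threshold k r * (Fintype.card V : ℝ) < (H.minPosCodegree : ℝ) →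
      H.UniquelyColorable k) ∧
    -- the constant is optimal
    IsLeast (RGraph.forcingConstants k r) (RGraph.threshold k r) ∧
    -- the minimum `Φ_{k,r}` as a maximum of the two expressions
    IsLeast (RGraph.forcingConstants k r)
      (max (((k : ℝ) - r + 1) / (k + 2)) ((3 * (k : ℝ) - 3 * r + 1) / (3 * k - 2))) ∧
    -- witness for the first constant
    (∀ m : ℕ, 1 ≤ m →
      k ≤ Fintype.card (RGraph.BlowupVertex k ⌊(1 : ℝ) * m⌋₊ m) ∧
      (RGraph.construction k r 1 m).Colorable k ∧
      (RGraph.construction k r 1 m).NoIsolated ∧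
      ((RGraph.construction k r 1 m).minPosCodegree : ℝ) =
        ((k : ℝ) - r + 1) / (k + 2) *
          (Fintype.card (RGraph.BlowupVertex k ⌊(1 : ℝ) * m⌋₊ m) : ℝ) ∧
      ¬ (RGraph.construction k r 1 m).UniquelyColorable k) ∧
    -- witness for the second constant
    (∀ m : ℕ, 1 ≤ m →
      k ≤ Fintype.card (RGraph.BlowupVertex k ⌊(3 : ℝ) * m⌋₊ m) ∧
      (RGraph.construction k r 3 m).Colorable k ∧
      (RGraph.construction k r 3 m).NoIsolated ∧
      ((RGraph.construction k r 3 m).minPosCodegree : ℝ) =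
        (3 * (k : ℝ) - 3 * r + 1) / (3 * k - 2) *
          (Fintype.card (RGraph.BlowupVertex k ⌊(3 : ℝ) * m⌋₊ m) : ℝ) ∧
      ¬ (RGraph.construction k r 3 m).UniquelyColorable k) := by
  have hk : 2 ≤ k := hr.trans hkr
  have h1 : ∀ m : ℕ, 1 ≤ m → 1 ≤ ⌊(1 : ℝ) * m⌋₊ := fun m hm => by simpa using hm
  have h3 : ∀ m : ℕ, 1 ≤ m → 1 ≤ ⌊(3 : ℝ) * m⌋₊ := fun m hm => by
    rw [RGraph.floor_three_mul]
    omega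
  refine ⟨fun V _ _ H => RGraph.uniquelyColorable_of_lt hr hkr,
    RGraph.isLeast_forcingConstants hr hkr,
    RGraph.threshold_eq_max hr hkr ▸ RGraph.isLeast_forcingConstants hr hkr,
    fun m hm => ⟨RGraph.le_card_blowupVertex (h1 m hm) hm, RGraph.colorable_twoHalves hk,
      RGraph.noIsolated_twoHalves hr hkr (h1 m hm) hm,
      RGraph.minPosCodegree_construction_one hr hkr hm,
      RGraph.not_uniquelyColorable_twoHalves hk hm⟩,
    fun m hm => ⟨RGraph.le_card_blowupVertex (h3 m hm) hm, RGraph.colorable_twoHalves hk,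
      RGraph.noIsolated_twoHalves hr hkr (h3 m hm) hm,
      RGraph.minPosCodegree_construction_three hr hkr hm,
      RGraph.not_uniquelyColorable_twoHalves hk hm⟩⟩
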